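/- **Theorem 3 (Consistency of $\widehat{\mathcal A}_{e_\ell}$).** *Setting.* Let $\mathcal X\subset\mathbb R^d$ be compact, let $\rho_{\mathbf x}$ be a probability measure on $\mathcal X$, and let $\mathcal H_K$ (norm $\|\cdot\|_K$) be the separable reproducing kernel Hilbert space of a measurable symmetric positive semi-definite kernel $K:\mathcal X\times\mathcal X\to\mathbb R$ with $\sup_{\mathbf x}\sqrt{K(\mathbf x,\mathbf x)}<\infty$ (separability is automatic if $K$ is continuous). Let $L_K g=\int K(\mathbf x,\cdot)\,g(\mathbf x)\,d\rho_{\mathbf x}(\mathbf x)$ be the integral operator $L_K:L_2(\mathcal X,\rho_{\mathbf x})\to\mathcal H_K$, which is also regarded as a positive operator on $L_2(\mathcal X,\rho_{\mathbf x})$, and let $\mathcal N(\lambda)=\operatorname{Tr}((L_K+\lambda I)^{-1}L_K)$. For $k=0,1,\dots,m$ ($k=0$ is the target, $k=1,\dots,m$ are the sources) let $\rho^{(k)}=\rho^{(k)}_{y|\mathbf x}\,\rho_{\mathbf x}$ be a distribution on $\mathcal X\times\mathbb R$ whose regression function $f^{(k)}_\rho(\mathbf x)=\int y\,d\rho^{(k)}_{y|\mathbf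 x}$ belongs to $\mathcal H_K$. Assume: 1. There are constants $B,\gamma>0$ such that for each $k$, $E[(y^{(k)})^2]<\infty$ and, for ($\rho_{\mathbf x}$-almost) every $\mathbf x$, $\int\big(e^{|y-f^{(k)}_\rho(\mathbf x)|/B}-\tfrac{|y-f^{(k)}_\rho(\mathbf x)|}{B}-1\big)\,d\rho^{(k)}_{y|\mathbf x}(y)\le\frac{\gamma^2}{2B^2}$. 2. There are $\alpha\in(0,1]$ and $Q\ge1$ with $\mathcal N(\lambda)\le Q\lambda^{-\alpha}$ for all $\lambda>0$. 3. There is $r$ with $\tfrac12<r\le1$ such that for each $k$, $f^{(k)}_\rho=L_K^r g^{(k)}_\rho$ (as elements of $\mathcal H_K$) for some $g^{(k)}_\rho\in L_2(\mathcal X,\rho_{\mathbf x})$. *True sets.* For $h\ge0$ let $\mathcal A_h=\{1\le k\le m:\|f^{(k)}_\rho-f^{(0)}_\rho\|_K\le h\}$. For $0\le\ell\le m$ let $h_\ell$ be the smallest $h\ge0$ with $|\mathcal A_h|\ge\ell$, and let $e_\ell=|\mathcal A_{h_\ell}|$. *Estimated sets.* For each $k$ let $(\mathbf x^{(k)}_i,y^{(k)}_i)$,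 $1\le i\le n_k$, be i.i.d. with law $\rho^{(k)}$. Independently of the target data, let $\mathcal T_1$ be a part of the target data that is chosen uniformly at random among all parts of a given size $s(n_0)\le n_0$, where $s(n_0)\ge c\,n_0$ for some $c>0$ and all large $n_0$ (for instance one half of the data). With $\mathcal S^{(0)}=\mathcal T_1$ and $\mathcal S^{(k)}=\{(\mathbf x^{(k)}_i,y^{(k)}_i)\}_{i=1}^{n_k}$ for $k\ge1$, let $$\widehat f^{(k)}=\operatorname*{argmin}_{f\in\mathcal H_K}\Big\{\frac1{|\mathcal S^{(k)}|}\sum_{(\mathbf x,y)\in\mathcal S^{(k)}}(f(\mathbf x)-y)^2+\lambda^{(k)}\|f\|_K^2\Big\},\qquad 0\le k\le m.$$ Let $\widehat R_k$ be the rank (in increasing order, ties broken arbitrarily) of $\|\widehat f^{(k)}-\widehat f^{(0)}\|_K$ among these norms for the sources $1,\dots,m$, and let $\widehat{\mathcal A}_{e_\ell}=\{1\le k\le m:\widehat R_k\le e_\ell\}$. *Conclusion.* If $\lambda^{(k)}\asymp n_k^{-1/(2r+\alpha)}$ for $0\le k\le m$, that is, if $\lambda^{(k)}/n_k^{-1/(2r+\alpha)}$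 stays between two positive constants, then, for each $0\le\ell\le m$, $$P\big(\widehat{\mathcal A}_{e_\ell}=\mathcal A_{h_\ell}\big)\to1\qquad\text{as }\min_{0\le k\le m}n_k\to\infty.$$ -/

import Mathlib

open MeasureTheory ProbabilityTheory Filter Topology
open scoped ENNReal InnerProductSpace

noncomputable section

namespace TransferKRR

/-! ### The reproducing kernel

`H` is a Hilbert space of real functions on `X` with continuous point evaluations, so it is the
reproducing kernel Hilbert space of its kernel `K`. By Moore's theorem every symmetric positive
semi-definite `K : X → X → ℝ` arises in this way, and `H` is determined by `K`. -/

section Kernel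

variable {X : Type*} (H : Type*) [NormedAddCommGroup H] [InnerProductSpace ℝ H] [CompleteSpace H]
  [RKHS ℝ H X ℝ]

/-- The kernel section `K_x = K(x, ·)`, as an element of the space `H`. -/
def kSec (x : X) : H := RKHS.kerFun H x (1 : ℝ)

/-- The real-valued kernel `K(x, y)`. -/
def ker (x y : X) : ℝ := kSec H x y

variable {H}

/-- The reproducing property `⟪f, K_x⟫ = f(x)`. -/
theorem inner_kSec (f : H) (x : X) : ⟪f, kSec H x⟫_ℝ = f x := by
  simp [kSec]

theorem ker_symm (x y : X) : ker H x y = ker H y x := by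
  unfold ker
  rw [← inner_kSec, ← inner_kSec, real_inner_comm]

variable (H) in
/-- The kernel is measurable and `sup_x √K(x,x) ≤ κ` for some positive constant `κ`. -/
structure IsBddMeasKernel [MeasurableSpace X] : Prop where
  measurable_ker : Measurable fun p : X × X => ker H p.1 p.2
  bounded : ∃ κ : ℝ, 0 < κ ∧ ∀ x, √(ker H x x) ≤ κ

theorem ker_self (x : X) : ker H x x = ‖kSec H x‖ ^ 2 := by
  unfold ker
  rw [← inner_kSec, real_inner_self_eq_norm_sq]

theorem IsBddMeasKernel.exists_norm_le [MeasurableSpace X] (hK : IsBddMeasKernel H) :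
    ∃ κ : ℝ, ∀ x, ‖kSec H x‖ ≤ κ := by
  obtain ⟨κ, -, h⟩ := hK.bounded
  refine ⟨κ, fun x => ?_⟩
  have := h x
  rwa [ker_self, Real.sqrt_sq (norm_nonneg _)] at this

theorem IsBddMeasKernel.measurable [MeasurableSpace X] (hK : IsBddMeasKernel H) (f : H) :
    Measurable (f : X → ℝ) := by
  have hd : f ∈ closure (Submodule.span ℝ {RKHS.kerFun H x v | (x : X) (v : ℝ)} : Set H) := by
    have h := RKHS.kerFun_dense (𝕜 := ℝ) (X := X) (V := ℝ) H
    rw [← Submodule.topologicalClosure_coe, h]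
    trivial
  obtain ⟨u, hu, hlim⟩ := mem_closure_iff_seq_limit.1 hd
  refine measurable_of_tendsto_metrizable (f := fun n => (u n : X → ℝ)) (fun n => ?_) ?_
  · refine Submodule.span_induction (p := fun (g : H) _ => Measurable (g : X → ℝ))
      ?_ ?_ ?_ ?_ (hu n)
    · rintro _ ⟨x, v, rfl⟩
      have h1 : RKHS.kerFun H x v = v • kSec H x := by
        rw [kSec, ← map_smul]; simp
      rw [h1, RKHS.coe_smul]
      exact (hK.measurable_ker.comp (measurable_const.prodMk measurable_id)).const_smul v
    · rw [RKHS.coe_zero]; exact measurable_const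
    · intro f g _ _ hf hg
      simpa using hf.add hg
    · intro a f _ hf
      simpa using hf.const_smul a
  · rw [tendsto_pi_nhds]
    exact fun x => ((RKHS.continuous_eval (𝕜 := ℝ) x).tendsto f).comp hlim

theorem IsBddMeasKernel.measurable_dist [MeasurableSpace X] (hK : IsBddMeasKernel H) (c : H) :
    Measurable fun x : X => dist (kSec H x) c := by
  have h2 : ∀ x : X, √(ker H x x - 2 * c x + ‖c‖ ^ 2) = dist (kSec H x) c := by
    intro x
    have h4 : ker H x x - 2 * c x + ‖c‖ ^ 2 = ‖kSec H x - c‖ ^ 2 := by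
      rw [norm_sub_sq_real, real_inner_comm, inner_kSec, ker_self]
    have h5 : dist (kSec H x) c = ‖kSec H x - c‖ := dist_eq_norm (kSec H x) c
    have h6 : 0 ≤ ‖kSec H x - c‖ := norm_nonneg (kSec H x - c)
    rw [h4, h5]
    exact Real.sqrt_sq h6
  simp_rw [← h2]
  have h7 : Measurable fun x : X => (x, x) := measurable_id.prodMk measurable_id
  have h10 : Measurable ((fun p : X × X => ker H p.1 p.2) ∘ fun x : X => (x, x)) :=
    hK.measurable_ker.comp h7
  have h3 : Measurable fun x : X => ker H x x := h10
  have h8 : Measurable fun x : X => 2 * c x := (hK.measurable c).const_mul 2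
  have h9 : Measurable fun x : X => ker H x x - 2 * c x + ‖c‖ ^ 2 := (h3.sub h8).add_const _
  exact Real.continuous_sqrt.measurable.comp h9

theorem IsBddMeasKernel.stronglyMeasurable_kSec [MeasurableSpace X]
    [TopologicalSpace.SeparableSpace H] (hK : IsBddMeasKernel H) :
    StronglyMeasurable fun x : X => kSec H x := by
  borelize H
  have : SecondCountableTopology H := UniformSpace.secondCountable_of_separable H
  refine Measurable.stronglyMeasurable ?_
  refine measurable_of_isOpen fun s hs => ?_
  have hball : ∀ (c : H) (r : ℝ), MeasurableSet ((fun x : X => kSec H x) ⁻¹' Metric.ball c r) :=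
    fun c r => measurableSet_lt (hK.measurable_dist c) measurable_const
  obtain ⟨D, hDc, hD⟩ := TopologicalSpace.exists_countable_dense H
  have hU : s = ⋃ c ∈ D, ⋃ q ∈ {q : ℚ | Metric.ball c q ⊆ s}, Metric.ball c q := by
    ext y
    simp only [Set.mem_iUnion, Set.mem_ofPred_eq, exists_prop]
    constructor
    · intro hy
      obtain ⟨ε, hε, hsub⟩ := Metric.isOpen_iff.1 hs y hy
      obtain ⟨q, hq0, hq⟩ := exists_rat_btwn (half_pos hε)
      obtain ⟨c, hcD, hc⟩ := hD.exists_dist_lt y hq0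
      refine ⟨c, hcD, q, fun z hz => hsub ?_, hc⟩
      rw [Metric.mem_ball] at hz ⊢
      calc dist z y ≤ dist z c + dist c y := dist_triangle _ _ _
        _ < q + q := by rw [dist_comm c y]; exact add_lt_add hz hc
        _ < ε := by linarith
    · rintro ⟨c, -, q, hq, hy⟩
      exact hq hy
  rw [hU]
  simp only [Set.preimage_iUnion]
  exact MeasurableSet.biUnion hDc fun c _ =>
    MeasurableSet.biUnion (Set.to_countable _) fun q _ => hball c q

end Kernel

/-! ### The integral operator -/

section Operator

variable {X : Type*} [MeasurableSpace X] {H : Type*} [NormedAddCommGroup H]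
  [InnerProductSpace ℝ H] [CompleteSpace H] [RKHS ℝ H X ℝ]

theorem IsBddMeasKernel.integrable [TopologicalSpace.SeparableSpace H]
    (hK : IsBddMeasKernel H) (ρ : Measure X) [IsProbabilityMeasure ρ] (g : Lp ℝ 2 ρ) : Integrable (fun x => g x • kSec H x) ρ := by
  obtain ⟨κ, hκ⟩ := hK.exists_norm_le
  have hg : Integrable g ρ := (Lp.memLp g).integrable (by norm_num)
  exact hg.smul_bdd κ hK.stronglyMeasurable_kSec.aestronglyMeasurable (ae_of_all _ hκ)

theorem IsBddMeasKernel.memLp (hK : IsBddMeasKernel H) (ρ : Measure X)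
    [IsProbabilityMeasure ρ] (f : H) : MemLp (f : X → ℝ) 2 ρ := by
  obtain ⟨κ, hκ⟩ := hK.exists_norm_le
  refine MemLp.of_bound (hK.measurable f).aestronglyMeasurable (‖f‖ * κ) (ae_of_all _ fun x => ?_)
  rw [← inner_kSec]
  exact (norm_inner_le_norm _ _).trans (by gcongr; exact hκ x)

/-- The inclusion of `H` into `L²(X, ρ)`. -/
def incl (hK : IsBddMeasKernel H) (ρ : Measure X) [IsProbabilityMeasure ρ] :
    H →L[ℝ] Lp ℝ 2 ρ :=
  LinearMap.mkContinuousOfExistsBound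
    { toFun := fun f => (hK.memLp ρ f).toLp f
      map_add' := fun f g => by
        rw [← MemLp.toLp_add]
        exact MemLp.toLp_congr _ _ (by simp)
      map_smul' := fun c f => by
        rw [RingHom.id_apply, ← MemLp.toLp_const_smul]
        exact MemLp.toLp_congr _ _ (by simp) } <| by
    obtain ⟨κ, hκ⟩ := hK.exists_norm_le
    have hne : Nonempty X := nonempty_of_isProbabilityMeasure ρ
    have hκ0 : 0 ≤ κ := (norm_nonneg _).trans (hκ hne.some)
    refine ⟨κ, fun f => ?_⟩
    have h := Lp.norm_le_of_ae_bound (p := 2) (f := (hK.memLp ρ f).toLp f) (C := κ * ‖f‖)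
      (by positivity) (by
        filter_upwards [(hK.memLp ρ f).coeFn_toLp] with x hx
        rw [hx, ← inner_kSec, mul_comm]
        exact (norm_inner_le_norm _ _).trans (by gcongr; exact hκ x))
    have h1 : measureUnivNNReal ρ = 1 := by simp [measureUnivNNReal]
    rw [h1] at h
    simpa using h

theorem incl_ae (hK : IsBddMeasKernel H) (ρ : Measure X) [IsProbabilityMeasure ρ] (f : H) :
    (incl hK ρ f : X → ℝ) =ᵐ[ρ] f :=
  (hK.memLp ρ f).coeFn_toLp

variable [TopologicalSpace.SeparableSpace H]

theorem inner_integral_kSec (hK : IsBddMeasKernel H) (ρ : Measure X) [IsProbabilityMeasure ρ]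
    (f : H) (g : Lp ℝ 2 ρ) :
    ⟪f, ∫ x, g x • kSec H x ∂ρ⟫_ℝ = ⟪incl hK ρ f, g⟫_ℝ := by
  rw [← integral_inner (hK.integrable ρ g), L2.inner_def]
  refine integral_congr_ae ?_
  filter_upwards [incl_ae hK ρ f] with x hx
  rw [hx, inner_smul_right, inner_kSec]
  simp

/-- The integral operator `L_K : L²(X, ρ) → H`, `L_K g = ∫ K_x g(x) dρ(x)`. -/
def LK (hK : IsBddMeasKernel H) (ρ : Measure X) [IsProbabilityMeasure ρ] :
    Lp ℝ 2 ρ →L[ℝ] H :=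
  LinearMap.mkContinuousOfExistsBound
    { toFun := fun g => ∫ x, g x • kSec H x ∂ρ
      map_add' := fun g g' => by
        rw [← integral_add (hK.integrable ρ g) (hK.integrable ρ g')]
        refine integral_congr_ae ?_
        filter_upwards [Lp.coeFn_add g g'] with x hx
        simp only [hx, Pi.add_apply, add_smul]
      map_smul' := fun c g => by
        rw [RingHom.id_apply, ← integral_smul]
        refine integral_congr_ae ?_
        filter_upwards [Lp.coeFn_smul c g] with x hx
        simp only [hx, Pi.smul_apply, smul_eq_mul, mul_smul] } <| by
    refine ⟨‖incl hK ρ‖, fun g => ?_⟩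
    change ‖∫ x, g x • kSec H x ∂ρ‖ ≤ _
    set v := ∫ x, g x • kSec H x ∂ρ with hv
    have h1 : ‖v‖ * ‖v‖ ≤ ‖v‖ * (‖incl hK ρ‖ * ‖g‖) := by
      rw [← real_inner_self_eq_norm_mul_norm]
      conv_lhs => rw [hv]
      rw [← hv, inner_integral_kSec]
      refine (real_inner_le_norm _ _).trans ?_
      rw [← mul_assoc, mul_comm ‖v‖]
      gcongr
      exact (incl hK ρ).le_opNorm v
    rcases (norm_nonneg v).eq_or_lt with h0 | h0
    · rw [← h0]; positivity
    · exact le_of_mul_le_mul_left h1 h0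

/-- `L_K` as an operator on `L²(X, ρ)`. -/
def LKop (hK : IsBddMeasKernel H) (ρ : Measure X) [IsProbabilityMeasure ρ] :
    Lp ℝ 2 ρ →L[ℝ] Lp ℝ 2 ρ :=
  incl hK ρ ∘L LK hK ρ

/-- The orthogonal projection of `L²(X, ρ)` onto the eigenspace `{g | L_K g = μ g}`
(it is `0` when `μ` is not an eigenvalue). -/
def eigProj (hK : IsBddMeasKernel H) (ρ : Measure X) [IsProbabilityMeasure ρ] (μ : ℝ) :
    Lp ℝ 2 ρ →L[ℝ] Lp ℝ 2 ρ :=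
  haveI : CompleteSpace
      (Module.End.eigenspace (LKop hK ρ : Module.End ℝ (Lp ℝ 2 ρ)) μ) :=
    ((LKop hK ρ).isClosed_eigenspace μ).completeSpace_coe
  (Module.End.eigenspace (LKop hK ρ : Module.End ℝ (Lp ℝ 2 ρ)) μ).starProjection

/-- `f = L_K^r g` as elements of `H`, for `r ≥ 1/2`. The spectral decomposition
`L_K = ∑ μ P_μ` (`P_μ` the projection onto the eigenspace of the eigenvalue `μ`) gives
`L_K^r g = ∑ μ^r P_μ g`. For `μ > 0` the element of `H` that represents `μ^r P_μ g` is
`μ^(r-1) L_K (P_μ g)`, since `L_K (P_μ g) = μ P_μ g`; the term of `μ = 0` vanishes, and all terms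
with `μ < 0` vanish because `L_K` is positive. The series of orthogonal terms converges in the
norm of `H`, as `‖μ^(r-1) L_K (P_μ g)‖_K = μ^(r-1/2) ‖P_μ g‖`. -/
def IsLKPow (hK : IsBddMeasKernel H) (ρ : Measure X) [IsProbabilityMeasure ρ] (r : ℝ)
    (g : Lp ℝ 2 ρ) (f : H) : Prop :=
  HasSum (fun μ : ℝ => μ ^ (r - 1) • LK hK ρ (eigProj hK ρ μ g)) f

/-- The trace `∑ᵢ ⟪eᵢ, A eᵢ⟫` of a positive operator `A` on a Hilbert space, over an orthonormal
basis `e`; the value (possibly infinite) does not depend on the basis. -/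
def posTrace {E : Type*} [NormedAddCommGroup E] [InnerProductSpace ℝ E] [CompleteSpace E]
    (A : E →L[ℝ] E) : ℝ≥0∞ :=
  ∑' e : (exists_hilbertBasis ℝ E).choose, ENNReal.ofReal ⟪(e : E), A e⟫_ℝ

/-- The effective dimension `𝒩(t) = Tr((L_K + t I)⁻¹ L_K)`, for `t > 0`. -/
def effDim (hK : IsBddMeasKernel H) (ρ : Measure X) [IsProbabilityMeasure ρ] (t : ℝ) : ℝ≥0∞ :=
  posTrace (Ring.inverse (LKop hK ρ + t • (1 : Lp ℝ 2 ρ →L[ℝ] Lp ℝ 2 ρ)) * LKop hK ρ)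

end Operator

/-! ### The regression models -/

section Model

variable {X : Type*} [MeasurableSpace X] {H : Type*} [NormedAddCommGroup H]
  [InnerProductSpace ℝ H] [CompleteSpace H] [RKHS ℝ H X ℝ]

/-- `f ∈ H` is the regression function `f(x) = ∫ y dρ(y|x)` of the conditional law `η = ρ(·|x)`
of the response, i.e. the noise `y - f(x)` has conditional mean zero. -/
def IsRegressionFun (ρ : Measure X) (η : Kernel X ℝ) (f : H) : Prop :=
  ∀ᵐ x ∂ρ, Integrable (fun y : ℝ => y) (η x) ∧ ∫ y, y ∂(η x) = f x

/-- `E[y²] < ∞`, and the conditional law of the noise satisfies the exponential moment bound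
`∫ (e^{|y - f(x)|/B} - |y - f(x)|/B - 1) dρ(y|x) ≤ γ²/(2B²)`. -/
def NoiseCondition (ρ : Measure X) (η : Kernel X ℝ) (f : H) (B γ : ℝ) : Prop :=
  Integrable (fun z : X × ℝ => z.2 ^ 2) (ρ ⊗ₘ η) ∧
  ∀ᵐ x ∂ρ, ∫⁻ y, ENNReal.ofReal (Real.exp (|y - f x| / B) - |y - f x| / B - 1) ∂(η x) ≤
    ENNReal.ofReal (γ ^ 2 / (2 * B ^ 2))

end Model

/-! ### Sampling -/

/-- On the probability space `(Ω, P)` there are `m + 1` datasets, the `k`-th one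
`Z k 0, …, Z k (n k - 1)` being i.i.d. with law `ρ k` (`k = 0` is the target dataset), and the
index set `T₁ ⊆ {0, …, n 0 - 1}` of the first part of the target data is drawn uniformly from all
subsets of size `s`, independently of the target data. -/
structure IsSample {X : Type*} [MeasurableSpace X] {m : ℕ} {Ω : Type*} [MeasurableSpace Ω]
    (P : Measure Ω) (ρ : Fin (m + 1) → Measure (X × ℝ)) (n : Fin (m + 1) → ℕ) (s : ℕ)
    (Z : (k : Fin (m + 1)) → Fin (n k) → Ω → X × ℝ) (T₁ : Ω → Finset (Fin (n 0))) : Prop where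
  measurable_data : ∀ k i, Measurable (Z k i)
  law : ∀ k i, P.map (Z k i) = ρ k
  indep : ∀ k, iIndepFun (Z k) P
  measurable_split : Measurable T₁
  uniform : ∀ A : Finset (Fin (n 0)), A.card = s → P (T₁ ⁻¹' {A}) = ((n 0).choose s : ℝ≥0∞)⁻¹
  indep_split : IndepFun T₁ (fun ω i => Z 0 i ω) P

/-! ### Estimators -/

section Estimator

variable {X : Type*} {H : Type*} [NormedAddCommGroup H] [InnerProductSpace ℝ H]
  [RKHS ℝ H X ℝ]

/-- The objective of kernel ridge regression on the data `(z i)`, `i ∈ S`. -/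
def krrObj {ι : Type*} (z : ι → X × ℝ) (S : Finset ι) (lam : ℝ) (f : H) : ℝ :=
  (S.card : ℝ)⁻¹ * ∑ i ∈ S, (f (z i).1 - (z i).2) ^ 2 + lam * ‖f‖ ^ 2

variable (H) in
/-- The kernel ridge regression estimator: the minimizer of `krrObj` over `H` (it exists and is
unique if `lam > 0`). -/
def krr {ι : Type*} (z : ι → X × ℝ) (S : Finset ι) (lam : ℝ) : H :=
  Classical.epsilon fun f : H => ∀ g : H, krrObj z S lam f ≤ krrObj z S lam g

variable (H) in
/-- The estimators `f̂⁽ᵏ⁾` for `k = 0, …, m`: the full `k`-th dataset is used if `k ≥ 1`, and only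
the part `T₁` of the target data if `k = 0`. -/
def fHat {m : ℕ} {n : Fin (m + 1) → ℕ} (z : (k : Fin (m + 1)) → Fin (n k) → X × ℝ)
    (T₁ : Finset (Fin (n 0))) (lam : Fin (m + 1) → ℝ) : Fin (m + 1) → H :=
  Fin.cons (krr H (z 0) T₁ (lam 0)) fun j : Fin m => krr H (z j.succ) Finset.univ (lam j.succ)

end Estimator

/-! ### Contrasts, transferable sets and ranks

The sources `1, …, m` are indexed by `j : Fin m`; source `j` is dataset `j.succ`. -/

/-- The RKHS norms `‖f⁽ᵏ⁾ - f⁽⁰⁾‖_K` of the contrasts, for the sources `k = 1, …, m`. -/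
def contrast {H : Type*} [NormedAddCommGroup H] {m : ℕ} (f : Fin (m + 1) → H) (j : Fin m) : ℝ :=
  ‖f j.succ - f 0‖

/-- The `h`-transferable set `𝒜_h = {k | ‖δ⁽ᵏ⁾‖_K ≤ h}`, for the contrast norms `v`. -/
def transferSet {m : ℕ} (v : Fin m → ℝ) (h : ℝ) : Finset (Fin m) := {j | v j ≤ h}

/-- `h_ℓ`, the smallest `h ≥ 0` with `|𝒜_h| ≥ ℓ`, for `0 ≤ ℓ ≤ m` (the infimum is attained). -/
def hLevel {m : ℕ} (v : Fin m → ℝ) (ℓ : ℕ) : ℝ :=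
  sInf {h : ℝ | 0 ≤ h ∧ ℓ ≤ (transferSet v h).card}

/-- `e_ℓ = |𝒜_{h_ℓ}|`. -/
def eLevel {m : ℕ} (v : Fin m → ℝ) (ℓ : ℕ) : ℕ := (transferSet v (hLevel v ℓ)).card

/-- `R j` is the rank of `v j` among `v 0, …, v (m - 1)` in increasing order (ranks start at `1`),
where ties may be broken in any way. -/
def IsRank {m : ℕ} (v : Fin m → ℝ) (R : Fin m → ℕ) : Prop :=
  ∀ j, Finset.card {i | v i < v j} < R j ∧ R j ≤ Finset.card {i | v i ≤ v j}

/-- The selected index set `𝒜̂_e = {k | R̂_k ≤ e}`. -/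
def selected {m : ℕ} (R : Fin m → ℕ) (e : ℕ) : Finset (Fin m) := {j | R j ≤ e}

end TransferKRR

end

open TransferKRR

/-!
The theorem reduces to consistency of each kernel ridge regression estimator in the norm of `H`:
once all errors `‖f̂⁽ᵏ⁾ - f⁽ᵏ⁾‖` are smaller than a quarter of the gap between `h_ℓ` and the next
contrast, the estimated contrasts separate `𝒜_{h_ℓ}` from its complement, and then its elements
occupy the first `e_ℓ` ranks however ties are broken (`selected_card_eq_transferSet`).

For consistency, let `T` be the covariance operator on `H`, `T̂` its empirical version and
`R = (T + λ)⁻¹`. The error `u = f̂ - f` satisfies `u = R (T - T̂) u + R ξ - λ R f` with the empirical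
noise `ξ`, so it is small once the three terms are (`norm_krr_sub_le`).

* The bias `λ R f` tends to `0` as `λ → 0` because the source condition places `f` in the closure
  of the range of `L_K` (`tendsto_bias`).
* The Hilbert–Schmidt norm of `R (T̂ - T)` and the norm of `R ξ` are controlled in mean square. They
  are averages of independent centred vectors, and their second moments are at most a constant times
  `E‖R K_x‖² / N` for a sample of size `N` (`exists_bad_set`); for the noise only its conditional
  variance matters.
* Comparing traces on `L²` and on `H` gives `λ E‖R K_x‖² ≤ 𝒩(λ)` (`mul_resMoment_le_effDim`), so the
  second moments are of the order `λ^{-1-α}/N`. For `λ ≍ N^{-1/(2r+α)}` this is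
  `N^{-(2r-1)/(2r+α)}`, which tends to `0` because `r > 1/2` (`tendsto_inv_mul_resMoment`).

The random part of the target data is handled by conditioning on the index set, which is independent
of the data (`measure_random_subset_le`).
-/

namespace TransferKRR

/-! ### Parseval's identity and Hilbert–Schmidt sums -/

section Hilbert

theorem enorm_sq_eq_ofReal {E : Type*} [NormedAddCommGroup E] (x : E) :
    ‖x‖ₑ ^ 2 = ENNReal.ofReal (‖x‖ ^ 2) := by
  rw [← ofReal_norm, ENNReal.ofReal_pow (norm_nonneg _)]

variable {E F : Type*} [NormedAddCommGroup E] [InnerProductSpace ℝ E]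
  [NormedAddCommGroup F] [InnerProductSpace ℝ F]

theorem tsum_enorm_inner_sq {ι : Type*} (b : HilbertBasis ι ℝ E) (x : E) :
    ∑' i, ‖⟪b i, x⟫_ℝ‖ₑ ^ 2 = ‖x‖ₑ ^ 2 := by
  have h := b.hasSum_inner_mul_inner x x
  have h' : HasSum (fun i => ‖⟪b i, x⟫_ℝ‖ ^ 2) (‖x‖ ^ 2) := by
    rw [← real_inner_self_eq_norm_sq]
    refine h.congr_fun fun i => ?_
    rw [real_inner_comm x (b i), Real.norm_eq_abs, sq_abs, sq]
  simp_rw [enorm_sq_eq_ofReal]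
  rw [← ENNReal.ofReal_tsum_of_nonneg (fun _ => by positivity) h'.summable, h'.tsum_eq]

/-- An orthonormal family in a separable space is countable, since the balls of radius `1/2`
around its members are disjoint. -/
theorem countable_of_orthonormal [TopologicalSpace.SeparableSpace E] {ι : Type*} {v : ι → E}
    (hv : Orthonormal ℝ v) : Countable ι := by
  refine Pairwise.countable_of_isOpen_disjoint (s := fun i => Metric.ball (v i) (1 / 2)) ?_
    (fun i => Metric.isOpen_ball) (fun i => ⟨v i, Metric.mem_ball_self (by norm_num)⟩)
  intro i j hij
  refine Metric.ball_disjoint_ball ?_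
  have h1 : ‖v i - v j‖ ^ 2 = 2 := by
    rw [norm_sub_sq_real, hv.2 hij, hv.1 i, hv.1 j]; norm_num
  have h2 : 0 ≤ ‖v i - v j‖ := norm_nonneg _
  rw [dist_eq_norm]
  nlinarith

theorem enorm_inner_le (v w : E) : ‖⟪v, w⟫_ℝ‖ₑ ≤ ‖v‖ₑ * ‖w‖ₑ := by
  simp only [← ofReal_norm]
  rw [← ENNReal.ofReal_mul (norm_nonneg _)]
  exact ENNReal.ofReal_le_ofReal (norm_inner_le_norm _ _)

variable [CompleteSpace E] [CompleteSpace F]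

/-- The Hilbert–Schmidt sum of an operator equals that of its adjoint. -/
theorem tsum_enorm_sq_adjoint {ι κ : Type*} (b : HilbertBasis ι ℝ E) (c : HilbertBasis κ ℝ F)
    (M : E →L[ℝ] F) :
    ∑' j, ‖M.adjoint (c j)‖ₑ ^ 2 = ∑' i, ‖M (b i)‖ₑ ^ 2 := by
  simp_rw [← tsum_enorm_inner_sq b, ← tsum_enorm_inner_sq c]
  rw [ENNReal.tsum_comm]
  refine tsum_congr fun i => tsum_congr fun j => ?_
  rw [ContinuousLinearMap.adjoint_inner_right, real_inner_comm]

/-- The operator norm is at most the Hilbert–Schmidt norm. -/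
theorem enorm_apply_sq_le_tsum {ι : Type*} (b : HilbertBasis ι ℝ E) (M : E →L[ℝ] F) (u : E) :
    ‖M u‖ₑ ^ 2 ≤ ‖u‖ₑ ^ 2 * ∑' i, ‖M (b i)‖ₑ ^ 2 := by
  obtain ⟨w, c, -⟩ := exists_hilbertBasis ℝ F
  rw [← tsum_enorm_inner_sq c, ← tsum_enorm_sq_adjoint b c, ← ENNReal.tsum_mul_left]
  refine ENNReal.tsum_le_tsum fun j => ?_
  rw [← ContinuousLinearMap.adjoint_inner_left, ← mul_pow]
  gcongr
  rw [mul_comm]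
  exact enorm_inner_le _ _

end Hilbert

/-! ### Regularized inverses -/

section Resolvent

variable {E : Type*} [NormedAddCommGroup E] [InnerProductSpace ℝ E] [CompleteSpace E]

theorem isUnit_add_smul_one (G : E →L[ℝ] E) (hG : ∀ u, 0 ≤ ⟪G u, u⟫_ℝ) {t : ℝ} (ht : 0 < t) :
    IsUnit (G + t • (1 : E →L[ℝ] E)) := by
  refine ContinuousLinearMap.isUnit_of_forall_le_norm_inner_map _ (c := t.toNNReal)
    (Real.toNNReal_pos.2 ht) fun u => ?_
  refine le_trans ?_ (le_abs_self _)
  have h : ⟪(G + t • (1 : E →L[ℝ] E)) u, u⟫_ℝ = ⟪G u, u⟫_ℝ + t * ‖u‖ ^ 2 := by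
    simp [inner_add_left, inner_smul_left]
  rw [h, Real.coe_toNNReal _ ht.le]
  nlinarith [hG u]

/-- The regularized inverse `(G + t I)⁻¹`. -/
noncomputable def regInv (G : E →L[ℝ] E) (t : ℝ) : E →L[ℝ] E :=
  Ring.inverse (G + t • (1 : E →L[ℝ] E))

variable {G : E →L[ℝ] E} {t : ℝ}

theorem regInv_apply_add (hG : ∀ u, 0 ≤ ⟪G u, u⟫_ℝ) (ht : 0 < t) (u : E) :
    regInv G t (G u + t • u) = u := by
  have h := Ring.inverse_mul_cancel _ (isUnit_add_smul_one G hG ht)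
  simpa [regInv] using congrArg (fun M : E →L[ℝ] E => M u) h

theorem apply_regInv_add (hG : ∀ u, 0 ≤ ⟪G u, u⟫_ℝ) (ht : 0 < t) (u : E) :
    G (regInv G t u) + t • regInv G t u = u := by
  have h := Ring.mul_inverse_cancel _ (isUnit_add_smul_one G hG ht)
  simpa [regInv] using congrArg (fun M : E →L[ℝ] E => M u) h

theorem inner_regInv_left (hG : ∀ u, 0 ≤ ⟪G u, u⟫_ℝ) (hs : ∀ u v, ⟪G u, v⟫_ℝ = ⟪u, G v⟫_ℝ)
    (ht : 0 < t) (u v : E) : ⟪regInv G t u, v⟫_ℝ = ⟪u, regInv G t v⟫_ℝ := by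
  conv_lhs => rw [← apply_regInv_add hG ht v]
  conv_rhs => rw [← apply_regInv_add hG ht u]
  simp only [inner_add_left, inner_add_right, inner_smul_left, inner_smul_right, hs]
  simp

theorem mul_norm_regInv_le (hG : ∀ u, 0 ≤ ⟪G u, u⟫_ℝ) (ht : 0 < t) (u : E) :
    t * ‖regInv G t u‖ ≤ ‖u‖ := by
  set p := regInv G t u with hp
  have h1 : G p + t • p = u := apply_regInv_add hG ht u
  have h2 : ⟪u, p⟫_ℝ = ⟪G p, p⟫_ℝ + t * ‖p‖ ^ 2 := by
    rw [← h1, inner_add_left, inner_smul_left, real_inner_self_eq_norm_sq]; simp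
  have h3 := real_inner_le_norm u p
  have h4 := hG p
  rcases (norm_nonneg p).eq_or_lt with h0 | h0
  · rw [← h0, mul_zero]; exact norm_nonneg u
  · refine le_of_mul_le_mul_right (a := ‖p‖) ?_ h0
    nlinarith

end Resolvent

/-! ### The covariance operator and the effective dimension -/

section Covariance

variable {X : Type*} [MeasurableSpace X] {H : Type*} [NormedAddCommGroup H]
  [InnerProductSpace ℝ H] [CompleteSpace H] [RKHS ℝ H X ℝ]
  (hK : IsBddMeasKernel H) (ρ : Measure X) [IsProbabilityMeasure ρ]

theorem lintegral_enorm_sq_eq (f : H) : ∫⁻ x, ‖f x‖ₑ ^ 2 ∂ρ = ‖incl hK ρ f‖ₑ ^ 2 := by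
  rw [enorm_sq_eq_ofReal, ← real_inner_self_eq_norm_sq, L2.inner_def,
    ofReal_integral_eq_lintegral_ofReal]
  · refine lintegral_congr_ae ?_
    filter_upwards [incl_ae hK ρ f] with x hx
    rw [hx, enorm_sq_eq_ofReal, real_inner_self_eq_norm_sq]
  · exact L2.integrable_inner _ _
  · exact ae_of_all _ fun x => real_inner_self_nonneg

variable [TopologicalSpace.SeparableSpace H]

/-- The covariance operator `T f = ∫ f(x) K_x dρ(x)` on `H`, i.e. the integral operator `L_K`
seen on `H` instead of `L²`. -/
noncomputable def covOp : H →L[ℝ] H := LK hK ρ ∘L incl hK ρ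

theorem inner_LK (f : H) (g : Lp ℝ 2 ρ) : ⟪f, LK hK ρ g⟫_ℝ = ⟪incl hK ρ f, g⟫_ℝ :=
  inner_integral_kSec hK ρ f g

theorem inner_LK_left (f : H) (g : Lp ℝ 2 ρ) : ⟪LK hK ρ g, f⟫_ℝ = ⟪g, incl hK ρ f⟫_ℝ := by
  rw [real_inner_comm, inner_LK, real_inner_comm]

theorem inner_covOp (u v : H) : ⟪covOp hK ρ u, v⟫_ℝ = ⟪incl hK ρ u, incl hK ρ v⟫_ℝ :=
  inner_LK_left hK ρ v _

theorem covOp_nonneg (u : H) : 0 ≤ ⟪covOp hK ρ u, u⟫_ℝ := by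
  rw [inner_covOp]; exact real_inner_self_nonneg

theorem covOp_symm (u v : H) : ⟪covOp hK ρ u, v⟫_ℝ = ⟪u, covOp hK ρ v⟫_ℝ := by
  rw [inner_covOp, real_inner_comm, ← inner_covOp, real_inner_comm]

theorem LKop_nonneg (g : Lp ℝ 2 ρ) : 0 ≤ ⟪LKop hK ρ g, g⟫_ℝ := by
  change 0 ≤ ⟪incl hK ρ (LK hK ρ g), g⟫_ℝ
  rw [← inner_LK]; exact real_inner_self_nonneg

/-- `‖(T + t)⁻¹ K_x‖²` averaged over `x`; it controls the variance of kernel ridge regression. -/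
noncomputable def resMoment (t : ℝ) : ℝ≥0∞ := ∫⁻ x, ‖regInv (covOp hK ρ) t (kSec H x)‖ₑ ^ 2 ∂ρ

theorem resMoment_eq {t : ℝ} (ht : 0 < t) {ι : Type*} (b : HilbertBasis ι ℝ (Lp ℝ 2 ρ)) :
    resMoment hK ρ t = ∑' i, ‖regInv (covOp hK ρ) t (LK hK ρ (b i))‖ₑ ^ 2 := by
  obtain ⟨w, c, hc⟩ := exists_hilbertBasis ℝ H
  have := countable_of_orthonormal c.orthonormal
  set R := regInv (covOp hK ρ) t with hR
  have hsymm : ∀ u v, ⟪R u, v⟫_ℝ = ⟪u, R v⟫_ℝ :=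
    inner_regInv_left (covOp_nonneg hK ρ) (covOp_symm hK ρ) ht
  have hadj : (incl hK ρ ∘L R).adjoint = R ∘L LK hK ρ := by
    refine ContinuousLinearMap.ext fun g => ext_inner_left ℝ fun f => ?_
    rw [ContinuousLinearMap.adjoint_inner_right, ContinuousLinearMap.comp_apply,
      ContinuousLinearMap.comp_apply, ← inner_LK, hsymm]
  have h1 := tsum_enorm_sq_adjoint c b (incl hK ρ ∘L R)
  rw [hadj] at h1
  simp only [ContinuousLinearMap.comp_apply] at h1
  rw [h1]
  simp_rw [← lintegral_enorm_sq_eq]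
  rw [← lintegral_tsum fun i => ((hK.measurable _).enorm.pow_const 2).aemeasurable]
  refine lintegral_congr fun x => ?_
  rw [← tsum_enorm_inner_sq c]
  refine tsum_congr fun i => ?_
  rw [← hsymm, inner_kSec]

/-- `t E‖(T + t)⁻¹ K_x‖² ≤ 𝒩(t)`: with `A` the inclusion of `H` into `L²`, both sides are traces
over `L²`, of `t (A (T + t)⁻¹) (A (T + t)⁻¹)*` and of `(A A* + t)⁻¹ A A* = A (T + t)⁻¹ A*`.
The second operator exceeds the first by the positive operator `(A (T + t)⁻¹ A*)²`. -/
theorem mul_resMoment_le_effDim {t : ℝ} (ht : 0 < t) :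
    ENNReal.ofReal t * resMoment hK ρ t ≤ effDim hK ρ t := by
  obtain ⟨b, hb⟩ := (exists_hilbertBasis ℝ (Lp ℝ 2 ρ)).choose_spec
  rw [resMoment_eq hK ρ ht b, effDim, posTrace, ← ENNReal.tsum_mul_left]
  refine ENNReal.tsum_le_tsum fun e => ?_
  have hbe : b e = (e : Lp ℝ 2 ρ) := by rw [hb]
  rw [hbe]
  generalize (e : Lp ℝ 2 ρ) = g
  set p := regInv (covOp hK ρ) t (LK hK ρ g) with hp
  have h1 : LK hK ρ (incl hK ρ p) + t • p = LK hK ρ g :=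
    apply_regInv_add (covOp_nonneg hK ρ) ht _
  have h2 : LKop hK ρ g = LKop hK ρ (incl hK ρ p) + t • incl hK ρ p := by
    change incl hK ρ (LK hK ρ g) = incl hK ρ (LK hK ρ (incl hK ρ p)) + _
    rw [← map_smul, ← map_add, h1]
  have h3 : (Ring.inverse (LKop hK ρ + t • (1 : Lp ℝ 2 ρ →L[ℝ] Lp ℝ 2 ρ)) * LKop hK ρ) g
      = incl hK ρ p := by
    change regInv (LKop hK ρ) t (LKop hK ρ g) = _
    rw [h2, regInv_apply_add (LKop_nonneg hK ρ) ht]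
  rw [h3, enorm_sq_eq_ofReal, ← ENNReal.ofReal_mul ht.le]
  refine ENNReal.ofReal_le_ofReal ?_
  rw [← inner_LK_left, ← h1, inner_add_left, inner_smul_left, real_inner_self_eq_norm_sq]
  have := covOp_nonneg hK ρ p
  simp only [conj_trivial]
  linarith [show 0 ≤ ⟪LK hK ρ (incl hK ρ p), p⟫_ℝ from this]

theorem resMoment_le_of_effDim_le {t M : ℝ} (ht : 0 < t)
    (h : effDim hK ρ t ≤ ENNReal.ofReal M) : resMoment hK ρ t ≤ ENNReal.ofReal (M / t) := by
  have h1 := (mul_resMoment_le_effDim hK ρ ht).trans h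
  rw [ENNReal.ofReal_div_of_pos ht, ENNReal.le_div_iff_mul_le (by simp [ht]) (by simp), mul_comm]
  exact h1

/-! ### The regularization bias -/

/-- `t ‖(T + t)⁻¹ L_K g‖ ≤ √t ‖g‖`. -/
theorem mul_norm_regInv_LK_le {t : ℝ} (ht : 0 < t) (g : Lp ℝ 2 ρ) :
    t * ‖regInv (covOp hK ρ) t (LK hK ρ g)‖ ≤ √t * ‖g‖ := by
  set p := regInv (covOp hK ρ) t (LK hK ρ g) with hp
  have h1 : covOp hK ρ p + t • p = LK hK ρ g := apply_regInv_add (covOp_nonneg hK ρ) ht _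
  have h2 : ‖incl hK ρ p‖ ^ 2 + t * ‖p‖ ^ 2 = ⟪g, incl hK ρ p⟫_ℝ := by
    rw [← inner_LK_left, ← h1, inner_add_left, inner_smul_left, inner_covOp,
      real_inner_self_eq_norm_sq, real_inner_self_eq_norm_sq]; simp
  have h3 := real_inner_le_norm g (incl hK ρ p)
  have h4 : t * ‖p‖ ^ 2 ≤ ‖g‖ ^ 2 := by
    nlinarith [sq_nonneg (‖g‖ - ‖incl hK ρ p‖), sq_nonneg (‖g‖)]
  refine le_of_sq_le_sq ?_ (by positivity)
  rw [mul_pow, mul_pow, Real.sq_sqrt ht.le]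
  nlinarith

/-- The bias `t (T + t)⁻¹ f` vanishes as `t → 0` if `f` is a limit of elements `L_K g`. -/
theorem tendsto_bias {f : H} (hf : f ∈ closure (Set.range (LK hK ρ))) {ε : ℝ} (hε : 0 < ε) :
    ∀ᶠ t in 𝓝[>] (0 : ℝ), t * ‖regInv (covOp hK ρ) t f‖ ≤ ε := by
  obtain ⟨_, ⟨g, rfl⟩, hg⟩ := Metric.mem_closure_iff.1 hf (ε / 2) (half_pos hε)
  have hlim : Tendsto (fun t : ℝ => √t * ‖g‖) (𝓝[>] 0) (𝓝 0) := by
    have : Tendsto (fun t : ℝ => √t * ‖g‖) (𝓝 0) (𝓝 (√0 * ‖g‖)) :=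
      (Real.continuous_sqrt.mul continuous_const).tendsto 0
    rw [Real.sqrt_zero, zero_mul] at this
    exact this.mono_left nhdsWithin_le_nhds
  filter_upwards [hlim.eventually (ge_mem_nhds (half_pos hε)), self_mem_nhdsWithin] with t h1 ht
  have ht : 0 < t := ht
  have h2 := mul_norm_regInv_le (covOp_nonneg hK ρ) ht (f - LK hK ρ g)
  have h3 := mul_norm_regInv_LK_le hK ρ ht g
  have h4 : regInv (covOp hK ρ) t f =
      regInv (covOp hK ρ) t (f - LK hK ρ g) + regInv (covOp hK ρ) t (LK hK ρ g) := by
    rw [← map_add, sub_add_cancel]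
  rw [dist_eq_norm] at hg
  rw [h4]
  calc _ ≤ t * (‖regInv (covOp hK ρ) t (f - LK hK ρ g)‖ + ‖regInv (covOp hK ρ) t (LK hK ρ g)‖) := by
        gcongr; exact norm_add_le _ _
    _ ≤ ε := by rw [mul_add]; linarith

theorem IsLKPow.mem_closure_range {r : ℝ} {g : Lp ℝ 2 ρ} {f : H} (h : IsLKPow hK ρ r g f) :
    f ∈ closure (Set.range (LK hK ρ)) := by
  refine mem_closure_of_tendsto h (Eventually.of_forall fun s => ?_)
  refine ⟨∑ μ ∈ s, μ ^ (r - 1) • eigProj hK ρ μ g, ?_⟩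
  simp only [map_sum, map_smul]

end Covariance

/-! ### The normal equation of kernel ridge regression -/

section NormalEquation

variable {X : Type*} {H : Type*} [NormedAddCommGroup H] [InnerProductSpace ℝ H] [CompleteSpace H]
  [RKHS ℝ H X ℝ] {ι : Type*} (z : ι → X × ℝ) (S : Finset ι)

/-- The empirical average `|S|⁻¹ ∑ F(zᵢ)` over the part `S` of the data. -/
noncomputable def empAvg {E V : Type*} [AddCommGroup V] [Module ℝ V] (z : ι → E) (S : Finset ι)
    (F : E → V) : V :=
  (S.card : ℝ)⁻¹ • ∑ i ∈ S, F (z i)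

theorem empAvg_sub {E V : Type*} [AddCommGroup V] [Module ℝ V] (z : ι → E)
    (F G : E → V) : empAvg z S (fun p => F p - G p) = empAvg z S F - empAvg z S G := by
  simp [empAvg, Finset.sum_sub_distrib, smul_sub]

variable (H) in
/-- The empirical covariance operator `f ↦ |S|⁻¹ ∑ f(xᵢ) K_{xᵢ}`. -/
noncomputable def empCov : H →L[ℝ] H :=
  empAvg z S fun p => (innerSL ℝ (kSec H p.1)).smulRight (kSec H p.1)

theorem empCov_apply (u : H) : empCov H z S u = empAvg z S fun p => u p.1 • kSec H p.1 := by
  simp only [empCov, empAvg, smul_apply, sum_apply,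
    ContinuousLinearMap.smulRight_apply, innerSL_apply_apply]
  refine congrArg _ (Finset.sum_congr rfl fun i _ => ?_)
  rw [real_inner_comm, inner_kSec]

theorem inner_empAvg_kSec (φ : X × ℝ → ℝ) (v : H) :
    ⟪v, empAvg z S fun p => φ p • kSec H p.1⟫_ℝ =
      (S.card : ℝ)⁻¹ * ∑ i ∈ S, φ (z i) * v (z i).1 := by
  simp only [empAvg, inner_smul_right, inner_sum, inner_kSec]

theorem empCov_nonneg (u : H) : 0 ≤ ⟪empCov H z S u, u⟫_ℝ := by
  rw [real_inner_comm, empCov_apply, inner_empAvg_kSec z S (fun p => u p.1)]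
  exact mul_nonneg (by positivity) (Finset.sum_nonneg fun i _ => mul_self_nonneg _)

variable (H) in
/-- The kernel ridge regression estimator solves the normal equation. -/
theorem krr_eq {lam : ℝ} (hlam : 0 < lam) :
    krr H z S lam = regInv (empCov H z S) lam (empAvg z S fun p => p.2 • kSec H p.1) := by
  set g := regInv (empCov H z S) lam (empAvg z S fun p => p.2 • kSec H p.1) with hg
  have hn : empCov H z S g + lam • g = empAvg z S fun p => p.2 • kSec H p.1 :=
    apply_regInv_add (empCov_nonneg z S) hlam _
  have key : ∀ h : H, krrObj z S lam (g + h) =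
      krrObj z S lam g + (⟪empCov H z S h, h⟫_ℝ + lam * ‖h‖ ^ 2) := by
    intro h
    have h1 := congrArg (fun v => ⟪h, v⟫_ℝ) hn
    simp only [inner_add_right, inner_smul_right, empCov_apply] at h1
    rw [inner_empAvg_kSec z S (fun p => g p.1), inner_empAvg_kSec z S (fun p => p.2)] at h1
    rw [real_inner_comm, empCov_apply, inner_empAvg_kSec z S (fun p => h p.1), krrObj, krrObj,
      norm_add_sq_real, real_inner_comm]
    have h2 : ∑ i ∈ S, ((g + h) (z i).1 - (z i).2) ^ 2 = ∑ i ∈ S, (g (z i).1 - (z i).2) ^ 2 +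
        (∑ i ∈ S, h (z i).1 * h (z i).1 + 2 * (∑ i ∈ S, g (z i).1 * h (z i).1 -
          ∑ i ∈ S, (z i).2 * h (z i).1)) := by
      rw [← Finset.sum_sub_distrib, Finset.mul_sum, ← Finset.sum_add_distrib,
        ← Finset.sum_add_distrib]
      refine Finset.sum_congr rfl fun i _ => ?_
      rw [RKHS.coe_add, Pi.add_apply]; ring
    rw [h2]
    linear_combination 2 * h1
  have hex : ∃ f : H, ∀ g' : H, krrObj z S lam f ≤ krrObj z S lam g' := by
    refine ⟨g, fun g' => ?_⟩
    have h1 := key (g' - g)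
    rw [add_sub_cancel] at h1
    have h2 := empCov_nonneg z S (g' - g)
    have h3 : 0 ≤ lam * ‖g' - g‖ ^ 2 := by positivity
    linarith
  have hmin := Classical.epsilon_spec hex g
  change krrObj z S lam (krr H z S lam) ≤ _ at hmin
  have h1 := key (krr H z S lam - g)
  rw [add_sub_cancel] at h1
  have h2 := empCov_nonneg z S (krr H z S lam - g)
  have h3 : lam * ‖krr H z S lam - g‖ ^ 2 ≤ 0 := by linarith
  have h4 : ‖krr H z S lam - g‖ ^ 2 ≤ 0 := by
    by_contra hc
    exact absurd (mul_pos hlam (not_le.1 hc)) (not_lt.2 h3)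
  have h5 : ‖krr H z S lam - g‖ = 0 := by
    have := norm_nonneg (krr H z S lam - g); nlinarith
  exact sub_eq_zero.1 (norm_eq_zero.1 h5)

/-- Perturbation bound: with `T` a positive operator close to the empirical covariance operator
relative to `R = (T + λ)⁻¹`, the error of kernel ridge regression is controlled by the regularized
noise `R ξ`, `ξ = |S|⁻¹ ∑ (yᵢ - f(xᵢ)) K_{xᵢ}`, and the bias `λ R f`. It rests on the identity
`u = R (T - T̂) u + R ξ - λ R f` for the error `u`. -/
theorem norm_krr_sub_le {T : H →L[ℝ] H} (hT : ∀ u, 0 ≤ ⟪T u, u⟫_ℝ) {lam : ℝ} (hlam : 0 < lam)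
    (hclose : ∀ u, ‖regInv T lam (empCov H z S u - T u)‖ ≤ 1 / 2 * ‖u‖) (f : H) :
    ‖krr H z S lam - f‖ ≤
      2 * (‖regInv T lam (empAvg z S fun p => (p.2 - f p.1) • kSec H p.1)‖ +
        lam * ‖regInv T lam f‖) := by
  set u := krr H z S lam - f with hu
  set ξ := empAvg z S fun p => (p.2 - f p.1) • kSec H p.1 with hξ
  have h1 : empCov H z S (krr H z S lam) + lam • krr H z S lam =
      empAvg z S fun p => p.2 • kSec H p.1 := by
    rw [krr_eq H z S hlam]
    exact apply_regInv_add (empCov_nonneg z S) hlam _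
  have h2 : ξ = (empAvg z S fun p => p.2 • kSec H p.1) - empCov H z S f := by
    rw [empCov_apply, ← empAvg_sub, hξ]
    simp only [sub_smul]
  have h3 : T u + lam • u = -(empCov H z S u - T u) + ξ - lam • f := by
    rw [h2, ← h1, hu, map_sub, map_sub, smul_sub]; abel
  have h4 : u = -regInv T lam (empCov H z S u - T u) + regInv T lam ξ - lam • regInv T lam f := by
    conv_lhs => rw [← regInv_apply_add hT hlam u, h3]
    rw [map_sub, map_add, map_neg, map_smul]
  have h5 : ‖u‖ ≤ ‖regInv T lam (empCov H z S u - T u)‖ + ‖regInv T lam ξ‖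
      + lam * ‖regInv T lam f‖ := by
    conv_lhs => rw [h4]
    refine (norm_sub_le _ _).trans ?_
    rw [norm_smul, Real.norm_of_nonneg hlam.le]
    gcongr
    refine (norm_add_le _ _).trans ?_
    rw [norm_neg]
  have h6 := hclose u
  linarith

end NormalEquation

/-! ### Variance of empirical averages -/

section Average

variable {Ω : Type*} [MeasurableSpace Ω] {P : Measure Ω} [IsProbabilityMeasure P]
  {E : Type*} [MeasurableSpace E] {ν : Measure E} {ι : Type*}
  {Z : ι → Ω → E}

theorem lintegral_enorm_empAvg_sub_sq_le (hZ : ∀ i, Measurable (Z i)) (hlaw : ∀ i, P.map (Z i) = ν)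
    (hind : iIndepFun Z P) {S : Finset ι} (hS : S.Nonempty) {φ : E → ℝ} (hφ : Measurable φ)
    (hφ2 : MemLp φ 2 ν) :
    ∫⁻ ω, ‖empAvg (fun i => Z i ω) S φ - ∫ p, φ p ∂ν‖ₑ ^ 2 ∂P ≤
      (S.card : ℝ≥0∞)⁻¹ * ∫⁻ p, ‖φ p‖ₑ ^ 2 ∂ν := by
  have hN : (0 : ℝ) < S.card := by exact_mod_cast hS.card_pos
  have hW : ∀ i, MemLp (φ ∘ Z i) 2 P := fun i => by
    have := hφ2
    rw [← hlaw i] at this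
    exact this.comp_of_map (hZ i).aemeasurable
  have hmean : ∀ i, ∫ ω, (φ ∘ Z i) ω ∂P = ∫ p, φ p ∂ν := fun i => by
    rw [← hlaw i, integral_map (hZ i).aemeasurable hφ.aestronglyMeasurable]; rfl
  have hsq : ∀ i, ∫ ω, (φ ∘ Z i) ω ^ 2 ∂P = ∫ p, φ p ^ 2 ∂ν := fun i => by
    rw [← hlaw i, integral_map (hZ i).aemeasurable (hφ.pow_const 2).aestronglyMeasurable]; rfl
  set Y : Ω → ℝ := fun ω => (S.card : ℝ)⁻¹ * (∑ i ∈ S, φ ∘ Z i) ω with hY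
  have hYL : MemLp Y 2 P := (memLp_finsetSum' S fun i _ => hW i).const_mul _
  have hYm : ∫ ω, Y ω ∂P = ∫ p, φ p ∂ν := by
    simp only [hY, Finset.sum_apply]
    rw [integral_const_mul, integral_finsetSum _ fun i _ => (hW i).integrable one_le_two]
    simp only [hmean, Finset.sum_const, nsmul_eq_mul]
    field_simp
  have hvar : Var[Y; P] ≤ (S.card : ℝ)⁻¹ * ∫ p, φ p ^ 2 ∂ν := by
    rw [hY, variance_const_mul, IndepFun.variance_sum fun i _ => hW i]
    · have : ∑ i ∈ S, Var[φ ∘ Z i; P] ≤ ∑ i ∈ S, ∫ p, φ p ^ 2 ∂ν :=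
        Finset.sum_le_sum fun i _ =>
          (variance_le_expectation_sq (hW i).aestronglyMeasurable).trans_eq (hsq i)
      rw [Finset.sum_const, nsmul_eq_mul] at this
      calc _ ≤ (S.card : ℝ)⁻¹ ^ 2 * (S.card * ∫ p, φ p ^ 2 ∂ν) := by gcongr
        _ = _ := by field_simp
    · intro i _ j _ hij
      exact (hind.indepFun hij).comp hφ hφ
  have h1 : ∫⁻ ω, ‖empAvg (fun i => Z i ω) S φ - ∫ p, φ p ∂ν‖ₑ ^ 2 ∂P = eVar[Y; P] := by
    rw [evariance, hYm]
    simp [hY, empAvg]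
  have h2 : ∫⁻ p, ‖φ p‖ₑ ^ 2 ∂ν = ENNReal.ofReal (∫ p, φ p ^ 2 ∂ν) := by
    rw [ofReal_integral_eq_lintegral_ofReal hφ2.integrable_sq (ae_of_all _ fun _ => sq_nonneg _)]
    refine lintegral_congr fun p => ?_
    rw [enorm_sq_eq_ofReal, Real.norm_eq_abs, sq_abs]
  rw [h1, h2, ← hYL.ofReal_variance_eq, ← ENNReal.ofReal_natCast, ← ENNReal.ofReal_inv_of_pos hN,
    ← ENNReal.ofReal_mul (by positivity)]
  exact ENNReal.ofReal_le_ofReal hvar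

theorem memLp_two_of_lintegral_ne_top {φ : E → ℝ} (hφ : Measurable φ)
    (h : ∫⁻ p, ‖φ p‖ₑ ^ 2 ∂ν ≠ ∞) : MemLp φ 2 ν := by
  refine ⟨hφ.aestronglyMeasurable, ?_⟩
  rw [eLpNorm_lt_top_iff_lintegral_rpow_enorm_lt_top (by norm_num) (by norm_num)]
  simpa using h.lt_top

variable {V : Type*} [NormedAddCommGroup V] [InnerProductSpace ℝ V] [CompleteSpace V]
  [TopologicalSpace.SeparableSpace V]

/-- The Hilbert space version of the `1/N` law for the variance of an average of `N` independent
variables, coordinate by coordinate; `μ` is the weak mean of `Y`. -/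
theorem lintegral_enorm_empAvg_sub_sq_le_of_weak (hZ : ∀ i, Measurable (Z i))
    (hlaw : ∀ i, P.map (Z i) = ν) (hind : iIndepFun Z P) {S : Finset ι} (hS : S.Nonempty)
    {Y : E → V} (hY : ∀ w, Measurable fun p => ⟪w, Y p⟫_ℝ) (hY2 : ∫⁻ p, ‖Y p‖ₑ ^ 2 ∂ν ≠ ∞)
    {μ : V} (hμ : ∀ w, ∫ p, ⟪w, Y p⟫_ℝ ∂ν = ⟪w, μ⟫_ℝ) :
    ∫⁻ ω, ‖empAvg (fun i => Z i ω) S Y - μ‖ₑ ^ 2 ∂P ≤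
      (S.card : ℝ≥0∞)⁻¹ * ∫⁻ p, ‖Y p‖ₑ ^ 2 ∂ν := by
  obtain ⟨s, b, -⟩ := exists_hilbertBasis ℝ V
  have := countable_of_orthonormal b.orthonormal
  have hL : ∀ w, MemLp (fun p => ⟪w, Y p⟫_ℝ) 2 ν := fun w => by
    refine memLp_two_of_lintegral_ne_top (hY w) (ne_top_of_le_ne_top
      (ENNReal.mul_ne_top (a := ‖w‖ₑ ^ 2) (by simp) hY2) ?_)
    rw [← lintegral_const_mul' _ _ (by simp)]
    refine lintegral_mono fun p => ?_
    rw [← mul_pow]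
    gcongr
    exact enorm_inner_le _ _
  have hav : ∀ w ω, ⟪w, empAvg (fun i => Z i ω) S Y - μ⟫_ℝ =
      empAvg (fun i => Z i ω) S (fun p => ⟪w, Y p⟫_ℝ) - ∫ p, ⟪w, Y p⟫_ℝ ∂ν := by
    intro w ω
    rw [hμ, inner_sub_right, empAvg, empAvg, inner_smul_right, inner_sum, smul_eq_mul]
  have hm : ∀ w, Measurable fun ω => ⟪w, empAvg (fun i => Z i ω) S Y - μ⟫_ℝ := by
    intro w
    rw [funext (hav w)]
    simp only [empAvg, smul_eq_mul]
    exact ((Finset.measurable_fun_sum S fun i _ => (hY w).comp (hZ i)).const_mul _).sub_const _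
  simp_rw [← tsum_enorm_inner_sq b]
  rw [lintegral_tsum fun i => ((hm _).enorm.pow_const 2).aemeasurable,
    lintegral_tsum fun i => ((hY _).enorm.pow_const 2).aemeasurable, ← ENNReal.tsum_mul_left]
  refine ENNReal.tsum_le_tsum fun i => ?_
  simp only [hav]
  exact lintegral_enorm_empAvg_sub_sq_le hZ hlaw hind hS (hY _) (hL _)

end Average

/-! ### Second moments of the noise -/

section Moments

variable {X : Type*} [MeasurableSpace X] {H : Type*} [NormedAddCommGroup H]
  [InnerProductSpace ℝ H] [RKHS ℝ H X ℝ] {ρ : Measure X} {η : Kernel X ℝ} {f : H}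

/-- The exponential moment condition bounds the conditional variance of the noise by `γ²`, as
`u²/2 ≤ eᵘ - u - 1` for `u ≥ 0`. -/
theorem NoiseCondition.ae_lintegral_sq_le {B γ : ℝ} (hB : 0 < B)
    (h : NoiseCondition ρ η f B γ) :
    ∀ᵐ x ∂ρ, ∫⁻ y, ‖y - f x‖ₑ ^ 2 ∂(η x) ≤ ENNReal.ofReal (γ ^ 2) := by
  filter_upwards [h.2] with x hx
  have h1 : ∀ y : ℝ, ‖y - f x‖ₑ ^ 2 ≤ ENNReal.ofReal (2 * B ^ 2) *
      ENNReal.ofReal (Real.exp (|y - f x| / B) - |y - f x| / B - 1) := by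
    intro y
    rw [enorm_sq_eq_ofReal, ← ENNReal.ofReal_mul (by positivity), Real.norm_eq_abs]
    refine ENNReal.ofReal_le_ofReal ?_
    have h2 := Real.quadratic_le_exp_of_nonneg (x := |y - f x| / B) (by positivity)
    have h3 : |y - f x| ^ 2 = 2 * B ^ 2 * ((|y - f x| / B) ^ 2 / 2) := by field_simp
    rw [h3]
    gcongr
    linarith
  calc _ ≤ ∫⁻ y, ENNReal.ofReal (2 * B ^ 2) *
        ENNReal.ofReal (Real.exp (|y - f x| / B) - |y - f x| / B - 1) ∂(η x) := lintegral_mono h1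
    _ = ENNReal.ofReal (2 * B ^ 2) * ∫⁻ y,
        ENNReal.ofReal (Real.exp (|y - f x| / B) - |y - f x| / B - 1) ∂(η x) :=
        lintegral_const_mul' _ _ ENNReal.ofReal_ne_top
    _ ≤ ENNReal.ofReal (2 * B ^ 2) * ENNReal.ofReal (γ ^ 2 / (2 * B ^ 2)) := by gcongr
    _ = ENNReal.ofReal (γ ^ 2) := by
        rw [← ENNReal.ofReal_mul (by positivity)]; congr 1; field_simp

theorem lintegral_comp_fst [SFinite ρ] [IsMarkovKernel η] {g : X → ℝ≥0∞} (hg : Measurable g) :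
    ∫⁻ p, g p.1 ∂(ρ ⊗ₘ η) = ∫⁻ x, g x ∂ρ := by
  rw [Measure.lintegral_compProd (f := fun p => g p.1) (hg.comp measurable_fst)]
  simp

variable [CompleteSpace H] [IsProbabilityMeasure ρ] [IsMarkovKernel η]

theorem lintegral_noise_smul_le (hK : IsBddMeasKernel H) {γ : ℝ}
    (hγ : ∀ᵐ x ∂ρ, ∫⁻ y, ‖y - f x‖ₑ ^ 2 ∂(η x) ≤ ENNReal.ofReal (γ ^ 2))
    {V : Type*} [NormedAddCommGroup V] [NormedSpace ℝ V] {G : X → V} (hG : StronglyMeasurable G) :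
    ∫⁻ p, ‖(p.2 - f p.1) • G p.1‖ₑ ^ 2 ∂(ρ ⊗ₘ η) ≤
      ENNReal.ofReal (γ ^ 2) * ∫⁻ x, ‖G x‖ₑ ^ 2 ∂ρ := by
  have hm : Measurable fun p : X × ℝ => ‖p.2 - f p.1‖ₑ ^ 2 :=
    (measurable_snd.sub ((hK.measurable f).comp measurable_fst)).enorm.pow_const 2
  have hGm : Measurable fun x => ‖G x‖ₑ ^ 2 := hG.enorm.pow_const 2
  simp only [enorm_smul, mul_pow]
  rw [Measure.lintegral_compProd (f := fun p => ‖p.2 - f p.1‖ₑ ^ 2 * ‖G p.1‖ₑ ^ 2)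
    (hm.mul (hGm.comp measurable_fst)), ← lintegral_const_mul _ hGm]
  refine lintegral_mono_ae ?_
  filter_upwards [hγ] with x hx
  rw [lintegral_mul_const]
  · gcongr
  · exact hm.comp measurable_prodMk_left

theorem integral_noise_mul_eq_zero (hK : IsBddMeasKernel H) {γ : ℝ}
    (hf : IsRegressionFun ρ η f)
    (hγ : ∀ᵐ x ∂ρ, ∫⁻ y, ‖y - f x‖ₑ ^ 2 ∂(η x) ≤ ENNReal.ofReal (γ ^ 2))
    {φ : X → ℝ} (hφ : Measurable φ) (hφ2 : ∫⁻ x, ‖φ x‖ₑ ^ 2 ∂ρ ≠ ∞) :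
    ∫ p, (p.2 - f p.1) * φ p.1 ∂(ρ ⊗ₘ η) = 0 := by
  have hm : Measurable fun p : X × ℝ => (p.2 - f p.1) * φ p.1 :=
    (measurable_snd.sub ((hK.measurable f).comp measurable_fst)).mul (hφ.comp measurable_fst)
  have h1 := lintegral_noise_smul_le hK hγ hφ.stronglyMeasurable
  have h2 : MemLp (fun p : X × ℝ => (p.2 - f p.1) * φ p.1) 2 (ρ ⊗ₘ η) :=
    memLp_two_of_lintegral_ne_top hm
      (ne_top_of_le_ne_top (ENNReal.mul_ne_top ENNReal.ofReal_ne_top hφ2) h1)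
  rw [Measure.integral_compProd (h2.integrable one_le_two)]
  refine integral_eq_zero_of_ae ?_
  filter_upwards [hf] with x hx
  simp only [Pi.zero_apply]
  rw [integral_mul_const, integral_sub hx.1 (integrable_const _), hx.2]
  simp

end Moments

/-! ### The probability of a large estimation error -/

section ErrorBound

variable {X : Type*} [MeasurableSpace X] {H : Type*} [NormedAddCommGroup H]
  [InnerProductSpace ℝ H] [CompleteSpace H] [RKHS ℝ H X ℝ] [TopologicalSpace.SeparableSpace H]
  (hK : IsBddMeasKernel H) {ρ : Measure X} [IsProbabilityMeasure ρ]

theorem empAvg_map {E V W ι : Type*} [AddCommGroup V] [Module ℝ V] [AddCommGroup W] [Module ℝ W]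
    (z : ι → E) (S : Finset ι) (F : E → V) (R : V →ₗ[ℝ] W) :
    R (empAvg z S F) = empAvg z S fun p => R (F p) := by
  simp [empAvg]

theorem stronglyMeasurable_empAvg {E V ι : Type*} [MeasurableSpace E] [NormedAddCommGroup V]
    [NormedSpace ℝ V] (S : Finset ι) {F : E → V} (hF : StronglyMeasurable F) :
    StronglyMeasurable fun z : ι → E => empAvg z S F := by
  simp only [empAvg]
  exact (Finset.stronglyMeasurable_fun_sum S fun i _ =>
    hF.comp_measurable (measurable_pi_apply i)).const_smul _

theorem lintegral_mul_apply_eq (v w : H) :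
    ∫ x, v x * w x ∂ρ = ⟪covOp hK ρ v, w⟫_ℝ := by
  rw [inner_covOp, L2.inner_def]
  refine integral_congr_ae ?_
  filter_upwards [incl_ae hK ρ v, incl_ae hK ρ w] with x h1 h2
  rw [h1, h2]; simp [mul_comm]

/-- Outside a measurable set `𝓑` of samples, whose probability is of the order of
`E‖(T + λ)⁻¹ K_x‖² / |S|`, the error of kernel ridge regression is smaller than `δ` as soon as the
bias is small. On the complement of `𝓑`, the operator `(T + λ)⁻¹ (T̂ - T)` has Hilbert–Schmidt norm
below `1/2` and the regularized noise has norm below `δ/8`. -/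
theorem exists_bad_set {η : Kernel X ℝ} [IsMarkovKernel η] {f : H} (hf : IsRegressionFun ρ η f)
    {γ κ : ℝ} (hγ : ∀ᵐ x ∂ρ, ∫⁻ y, ‖y - f x‖ₑ ^ 2 ∂(η x) ≤ ENNReal.ofReal (γ ^ 2))
    (hκ : ∀ x, ‖kSec H x‖ ≤ κ) {t δ : ℝ} (ht : 0 < t) (hδ : 0 < δ)
    (hq : resMoment hK ρ t ≠ ∞) (hbias : t * ‖regInv (covOp hK ρ) t f‖ ≤ δ / 8)
    {Ω ι : Type*} [MeasurableSpace Ω] {P : Measure Ω} [IsProbabilityMeasure P]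
    {Z : ι → Ω → X × ℝ} (hZ : ∀ i, Measurable (Z i)) (hlaw : ∀ i, P.map (Z i) = ρ ⊗ₘ η)
    (hind : iIndepFun Z P) {S : Finset ι} (hS : S.Nonempty) :
    ∃ 𝓑 : Set (ι → X × ℝ), MeasurableSet 𝓑 ∧ (∀ z ∉ 𝓑, ‖krr H z S t - f‖ < δ) ∧
      P {ω | (fun i => Z i ω) ∈ 𝓑} ≤ ENNReal.ofReal (4 * κ ^ 2 + 64 * γ ^ 2 / δ ^ 2) *
        ((S.card : ℝ≥0∞)⁻¹ * resMoment hK ρ t) := by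
  obtain ⟨s, b, -⟩ := exists_hilbertBasis ℝ H
  have := countable_of_orthonormal b.orthonormal
  set T := covOp hK ρ with hT
  set R := regInv T t with hR
  have hsymm : ∀ u v, ⟪R u, v⟫_ℝ = ⟪u, R v⟫_ℝ :=
    inner_regInv_left (covOp_nonneg hK ρ) (covOp_symm hK ρ) ht
  have hRK : StronglyMeasurable fun x : X => R (kSec H x) :=
    R.continuous.comp_stronglyMeasurable hK.stronglyMeasurable_kSec
  have hinner : ∀ (w : H) x, ⟪w, R (kSec H x)⟫_ℝ = (R w) x := fun w x => by
    rw [← hsymm, inner_kSec]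
  -- the terms of the regularized covariance, in the direction `v`, and of the regularized noise
  set Y₁ : H → X × ℝ → H := fun v p => v p.1 • R (kSec H p.1) with hY₁
  set Y₂ : X × ℝ → H := fun p => (p.2 - f p.1) • R (kSec H p.1) with hY₂
  have hY₁m : ∀ v, StronglyMeasurable (Y₁ v) := fun v =>
    ((hK.measurable v).comp measurable_fst).stronglyMeasurable.smul
      (hRK.comp_measurable measurable_fst)
  have hY₂m : StronglyMeasurable Y₂ :=
    (measurable_snd.sub ((hK.measurable f).comp measurable_fst)).stronglyMeasurable.smul
      (hRK.comp_measurable measurable_fst)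
  have hκ2 : ∑' i, ∫⁻ p, ‖Y₁ (b i) p‖ₑ ^ 2 ∂(ρ ⊗ₘ η) ≤
      ENNReal.ofReal (κ ^ 2) * resMoment hK ρ t := by
    rw [← lintegral_tsum fun i => ((hY₁m _).enorm.pow_const 2).aemeasurable]
    have h1 : ∀ p : X × ℝ, ∑' i, ‖Y₁ (b i) p‖ₑ ^ 2 =
        ‖kSec H p.1‖ₑ ^ 2 * ‖R (kSec H p.1)‖ₑ ^ 2 := by
      intro p
      simp only [hY₁, enorm_smul, mul_pow]
      rw [ENNReal.tsum_mul_right, ← tsum_enorm_inner_sq b (kSec H p.1)]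
      simp only [inner_kSec]
    simp only [h1]
    rw [resMoment, ← lintegral_const_mul _ (hRK.enorm.pow_const 2),
      lintegral_comp_fst (g := fun x => ‖kSec H x‖ₑ ^ 2 * ‖R (kSec H x)‖ₑ ^ 2)
        ((hK.stronglyMeasurable_kSec.enorm.pow_const 2).mul (hRK.enorm.pow_const 2))]
    refine lintegral_mono fun x => ?_
    rw [enorm_sq_eq_ofReal (kSec H x)]
    gcongr
    exact hκ x
  have hY₂2 : ∫⁻ p, ‖Y₂ p‖ₑ ^ 2 ∂(ρ ⊗ₘ η) ≤ ENNReal.ofReal (γ ^ 2) * resMoment hK ρ t :=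
    lintegral_noise_smul_le hK hγ hRK
  set U₁ : (ι → X × ℝ) → ℝ≥0∞ := fun z => ∑' i, ‖empAvg z S (Y₁ (b i)) - R (T (b i))‖ₑ ^ 2 with hU₁
  set U₂ : (ι → X × ℝ) → ℝ≥0∞ := fun z => ‖empAvg z S Y₂ - 0‖ₑ ^ 2 with hU₂
  have hU₁m : Measurable U₁ := Measurable.tsum fun i =>
    ((stronglyMeasurable_empAvg S (hY₁m _)).sub stronglyMeasurable_const).enorm.pow_const 2
  have hU₂m : Measurable U₂ :=
    ((stronglyMeasurable_empAvg S hY₂m).sub stronglyMeasurable_const).enorm.pow_const 2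
  have hdata : Measurable fun ω i => Z i ω := measurable_pi_lambda _ hZ
  have hE₁ : ∫⁻ ω, U₁ (fun i => Z i ω) ∂P ≤
      (S.card : ℝ≥0∞)⁻¹ * (ENNReal.ofReal (κ ^ 2) * resMoment hK ρ t) := by
    refine le_trans ?_ (mul_le_mul_right hκ2 _)
    have hm : ∀ i, Measurable fun ω =>
        ‖empAvg (fun j => Z j ω) S (Y₁ (b i)) - R (T (b i))‖ₑ ^ 2 := fun i =>
      (((stronglyMeasurable_empAvg S (hY₁m (b i))).comp_measurable hdata).sub
        stronglyMeasurable_const).enorm.pow_const 2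
    rw [lintegral_tsum fun i => (hm i).aemeasurable, ← ENNReal.tsum_mul_left]
    refine ENNReal.tsum_le_tsum fun i => ?_
    refine lintegral_enorm_empAvg_sub_sq_le_of_weak hZ hlaw hind hS (fun w => ?_)
      (ENNReal.ne_top_of_tsum_ne_top
        (ne_top_of_le_ne_top (ENNReal.mul_ne_top ENNReal.ofReal_ne_top hq) hκ2) i) fun w => ?_
    · exact (stronglyMeasurable_const.inner (hY₁m _)).measurable
    · simp only [hY₁, inner_smul_right, hinner]
      rw [← hsymm, real_inner_comm, ← lintegral_mul_apply_eq hK (b i) (R w)]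
      have hm : Measurable fun x => (b i) x * (R w) x :=
        (hK.measurable _).mul (hK.measurable _)
      have := integral_map (μ := ρ ⊗ₘ η) measurable_fst.aemeasurable hm.aestronglyMeasurable
      rw [← this]
      congr 1
      exact Measure.fst_compProd ρ η
  have hE₂ : ∫⁻ ω, U₂ (fun i => Z i ω) ∂P ≤
      (S.card : ℝ≥0∞)⁻¹ * (ENNReal.ofReal (γ ^ 2) * resMoment hK ρ t) := by
    refine le_trans ?_ (mul_le_mul_right hY₂2 _)
    refine lintegral_enorm_empAvg_sub_sq_le_of_weak hZ hlaw hind hS (fun w => ?_)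
      (ne_top_of_le_ne_top (ENNReal.mul_ne_top ENNReal.ofReal_ne_top hq) hY₂2) fun w => ?_
    · exact (stronglyMeasurable_const.inner hY₂m).measurable
    · simp only [hY₂, inner_smul_right, hinner, inner_zero_right]
      refine integral_noise_mul_eq_zero hK hf hγ (hK.measurable _) ?_
      rw [lintegral_enorm_sq_eq hK]
      simp
  refine ⟨{z | ENNReal.ofReal (1 / 4) ≤ U₁ z} ∪ {z | ENNReal.ofReal ((δ / 8) ^ 2) ≤ U₂ z},
    (measurableSet_le measurable_const hU₁m).union (measurableSet_le measurable_const hU₂m),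
    fun z hz => ?_, ?_⟩
  · simp only [Set.mem_union, Set.mem_ofPred_eq, not_or, not_le] at hz
    have hclose : ∀ u, ‖R (empCov H z S u - T u)‖ ≤ 1 / 2 * ‖u‖ := by
      intro u
      have h1 := enorm_apply_sq_le_tsum b (R ∘L (empCov H z S - T)) u
      have h2 : ∀ i, (R ∘L (empCov H z S - T)) (b i) =
          empAvg z S (Y₁ (b i)) - R (T (b i)) := fun i => by
        rw [ContinuousLinearMap.comp_apply, sub_apply, map_sub, empCov_apply]
        congr 1
        refine (empAvg_map z S _ R.toLinearMap).trans ?_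
        simp [hY₁]
      simp only [h2] at h1
      have h3 := h1.trans (mul_le_mul_right hz.1.le _)
      rw [enorm_sq_eq_ofReal, enorm_sq_eq_ofReal, ← ENNReal.ofReal_mul (by positivity),
        ENNReal.ofReal_le_ofReal_iff (by positivity)] at h3
      refine le_of_sq_le_sq ?_ (by positivity)
      change ‖R (empCov H z S u - T u)‖ ^ 2 ≤ _ at h3
      linarith
    have hnoise : ‖R (empAvg z S fun p => (p.2 - f p.1) • kSec H p.1)‖ < δ / 8 := by
      have h1 : R (empAvg z S fun p => (p.2 - f p.1) • kSec H p.1) = empAvg z S Y₂ := by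
        refine (empAvg_map z S _ R.toLinearMap).trans ?_
        simp [hY₂]
      have h2 := hz.2
      rw [hU₂] at h2
      simp only [sub_zero] at h2
      rw [← h1, enorm_sq_eq_ofReal, ENNReal.ofReal_lt_ofReal_iff (by positivity)] at h2
      exact lt_of_pow_lt_pow_left₀ 2 (by positivity) h2
    have h := norm_krr_sub_le z S (covOp_nonneg hK ρ) ht hclose f
    have hbias' : t * ‖R f‖ ≤ δ / 8 := hbias
    have h' : ‖krr H z S t - f‖ ≤ 2 * (‖R (empAvg z S fun p => (p.2 - f p.1) • kSec H p.1)‖ +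
        t * ‖R f‖) := h
    linarith
  · have hP₁ : P {ω | ENNReal.ofReal (1 / 4) ≤ U₁ (fun i => Z i ω)} ≤
        ENNReal.ofReal (4 * κ ^ 2) * ((S.card : ℝ≥0∞)⁻¹ * resMoment hK ρ t) := by
      refine (meas_ge_le_lintegral_div (hU₁m.comp hdata).aemeasurable (by simp) (by simp)).trans ?_
      refine (ENNReal.div_le_div_right hE₁ _).trans (le_of_eq ?_)
      rw [mul_left_comm, ENNReal.mul_div_right_comm, ← ENNReal.ofReal_div_of_pos (by norm_num)]
      congr 2; ring_nf
    have hP₂ : P {ω | ENNReal.ofReal ((δ / 8) ^ 2) ≤ U₂ (fun i => Z i ω)} ≤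
        ENNReal.ofReal (64 * γ ^ 2 / δ ^ 2) * ((S.card : ℝ≥0∞)⁻¹ * resMoment hK ρ t) := by
      have hpos : 0 < (δ / 8) ^ 2 := by positivity
      refine (meas_ge_le_lintegral_div (hU₂m.comp hdata).aemeasurable (by simpa using hδ.ne')
        (by simp)).trans ?_
      refine (ENNReal.div_le_div_right hE₂ _).trans (le_of_eq ?_)
      rw [mul_left_comm, ENNReal.mul_div_right_comm, ← ENNReal.ofReal_div_of_pos hpos]
      congr 2; field_simp; norm_num
    rw [ENNReal.ofReal_add (by positivity) (by positivity), add_mul]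
    exact (measure_union_le _ _).trans (add_le_add hP₁ hP₂)

end ErrorBound

/-! ### The random split of the target data -/

/-- If an index set `T`, uniform among the sets of size `s`, is independent of the data `D`, then
conditioning on `T = A` leaves the law of `D` unchanged, so that bounds for every fixed `A` carry
over. The event contains all `ω` with `|T ω| ≠ s`, which form a null set. -/
theorem measure_random_subset_le {Ω 𝒟 : Type*} [MeasurableSpace Ω] [MeasurableSpace 𝒟]
    {P : Measure Ω} [IsProbabilityMeasure P] {N s : ℕ} (hs : s ≤ N) {T : Ω → Finset (Fin N)}
    (hT : Measurable T)
    (hu : ∀ A : Finset (Fin N), A.card = s → P (T ⁻¹' {A}) = (N.choose s : ℝ≥0∞)⁻¹)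
    {D : Ω → 𝒟} (hind : IndepFun T D P) {𝓑 : Finset (Fin N) → Set 𝒟}
    (h𝓑 : ∀ A, A.card = s → MeasurableSet (𝓑 A)) {β : ℝ≥0∞}
    (hβ : ∀ A, A.card = s → P (D ⁻¹' 𝓑 A) ≤ β) :
    P {ω | (T ω).card = s → D ω ∈ 𝓑 (T ω)} ≤ β := by
  set 𝒞 : Finset (Finset (Fin N)) := Finset.powersetCard s Finset.univ with h𝒞
  have hmem : ∀ A, A ∈ 𝒞 ↔ A.card = s := by simp [h𝒞, Finset.mem_powersetCard]
  have hcard : 𝒞.card = N.choose s := by simp [h𝒞]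
  have hne : (N.choose s : ℝ≥0∞) ≠ 0 := by exact_mod_cast (Nat.choose_pos hs).ne'
  have htot : ∀ x : ℝ≥0∞, ∑ A ∈ 𝒞, P (T ⁻¹' {A}) * x = x := by
    intro x
    rw [Finset.sum_congr rfl fun A hA => by rw [hu A ((hmem A).1 hA)], Finset.sum_const, hcard,
      nsmul_eq_mul, ← mul_assoc, ENNReal.mul_inv_cancel hne (ENNReal.natCast_ne_top _), one_mul]
  have hnull : P (T ⁻¹' (𝒞 : Set (Finset (Fin N))))ᶜ = 0 := by
    rw [prob_compl_eq_zero_iff (hT (Finset.measurableSet _)), ← sum_measure_preimage_singleton 𝒞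
      fun A _ => hT (measurableSet_singleton A)]
    simpa using htot 1
  have hsub : {ω | (T ω).card = s → D ω ∈ 𝓑 (T ω)} ⊆
      (T ⁻¹' (𝒞 : Set (Finset (Fin N))))ᶜ ∪ ⋃ A ∈ 𝒞, T ⁻¹' {A} ∩ D ⁻¹' 𝓑 A := by
    intro ω hω
    by_cases hc : (T ω).card = s
    · right
      simp only [Set.mem_iUnion]
      exact ⟨T ω, (hmem _).2 hc, rfl, hω hc⟩
    · left
      simpa [hmem] using hc
  calc _ ≤ P ((T ⁻¹' (𝒞 : Set (Finset (Fin N))))ᶜ ∪ ⋃ A ∈ 𝒞, T ⁻¹' {A} ∩ D ⁻¹' 𝓑 A) :=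
        measure_mono hsub
    _ ≤ 0 + ∑ A ∈ 𝒞, P (T ⁻¹' {A} ∩ D ⁻¹' 𝓑 A) := by
        refine (measure_union_le _ _).trans ?_
        rw [hnull]
        gcongr
        exact measure_biUnion_finset_le _ _
    _ ≤ ∑ A ∈ 𝒞, P (T ⁻¹' {A}) * β := by
        rw [zero_add]
        refine Finset.sum_le_sum fun A hA => ?_
        have hA' := (hmem A).1 hA
        rw [hind.measure_inter_preimage_eq_mul _ _ (measurableSet_singleton A) (h𝓑 A hA')]
        gcongr
        exact hβ A hA'
    _ = β := htot β

/-! ### Rates -/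

section Rates

variable {X : Type*} [MeasurableSpace X] {H : Type*} [NormedAddCommGroup H]
  [InnerProductSpace ℝ H] [CompleteSpace H] [RKHS ℝ H X ℝ] [TopologicalSpace.SeparableSpace H]
  (hK : IsBddMeasKernel H) (ρ : Measure X) [IsProbabilityMeasure ρ]

theorem tendsto_nhdsGT_of_le_rpow {ι : Type*} {F : Filter ι} {N : ι → ℕ} (hN : Tendsto N F atTop)
    {p : ℝ} (hp : 0 < p) {c C : ℝ} (hc : 0 < c) {lam : ι → ℝ}
    (hlam : ∀ᶠ n in F, c * (N n : ℝ) ^ (-(1 / p)) ≤ lam n ∧ lam n ≤ C * (N n : ℝ) ^ (-(1 / p))) :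
    Tendsto lam F (𝓝[>] 0) := by
  have hNR : Tendsto (fun n => (N n : ℝ)) F atTop := tendsto_natCast_atTop_atTop.comp hN
  have h1 : Tendsto (fun n => (N n : ℝ) ^ (-(1 / p))) F (𝓝 0) :=
    (tendsto_rpow_neg_atTop (by positivity)).comp hNR
  have hpos : ∀ᶠ n in F, 0 < lam n := by
    filter_upwards [hlam, hN.eventually_ge_atTop 1] with n hn h1n
    have : (0 : ℝ) < N n := by exact_mod_cast h1n
    exact lt_of_lt_of_le (by positivity) hn.1
  refine tendsto_nhdsWithin_iff.2 ⟨?_, hpos⟩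
  refine squeeze_zero' (hpos.mono fun n h => h.le) (hlam.mono fun n h => h.2) ?_
  simpa using h1.const_mul C

/-- With `λ ≥ c N^{-1/(2r+α)}` and `M ≥ c' N`, the variance is of the order
`λ^{-1-α}/M = O(N^{-(2r-1)/(2r+α)})`, which tends to `0` since `r > 1/2`. -/
theorem tendsto_inv_mul_resMoment {α Q r : ℝ} (hα : 0 < α) (hQ : 0 ≤ Q) (hr : 1 / 2 < r)
    (h_dim : ∀ t : ℝ, 0 < t → effDim hK ρ t ≤ ENNReal.ofReal (Q * t ^ (-α)))
    {ι : Type*} {F : Filter ι} {N M : ι → ℕ} (hN : Tendsto N F atTop) {c' : ℝ} (hc' : 0 < c')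
    (hM : ∀ᶠ n in F, c' * N n ≤ M n) {c : ℝ} (hc : 0 < c) {lam : ι → ℝ}
    (hlam : ∀ᶠ n in F, c * (N n : ℝ) ^ (-(1 / (2 * r + α))) ≤ lam n) :
    Tendsto (fun n => (M n : ℝ≥0∞)⁻¹ * resMoment hK ρ (lam n)) F (𝓝 0) := by
  set p := 2 * r + α with hp
  have hp0 : 0 < p := by linarith
  have hNR : Tendsto (fun n => (N n : ℝ)) F atTop := tendsto_natCast_atTop_atTop.comp hN
  set A : ℝ := Q * c ^ (-α) / c / c' with hA
  have h1 : Tendsto (fun n => ENNReal.ofReal (A * (N n : ℝ) ^ (-((2 * r - 1) / p)))) F (𝓝 0) := by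
    have h2 : Tendsto (fun n => (N n : ℝ) ^ (-((2 * r - 1) / p))) F (𝓝 0) :=
      (tendsto_rpow_neg_atTop (div_pos (by linarith) hp0)).comp hNR
    have h3 := ENNReal.tendsto_ofReal (h2.const_mul A)
    simpa using h3
  refine tendsto_of_tendsto_of_tendsto_of_le_of_le' tendsto_const_nhds h1
    (Eventually.of_forall fun _ => zero_le) ?_
  filter_upwards [hlam, hM, hN.eventually_ge_atTop 1] with n hn hMn h1n
  have hNpos : (0 : ℝ) < N n := by exact_mod_cast h1n
  have hMpos : (0 : ℝ) < M n := lt_of_lt_of_le (by positivity) hMn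
  set a := (N n : ℝ) ^ (-(1 / p)) with ha
  have hapos : 0 < a := Real.rpow_pos_of_pos hNpos _
  have hl : 0 < lam n := lt_of_lt_of_le (by positivity) hn
  have h4 := resMoment_le_of_effDim_le hK ρ hl (h_dim _ hl)
  calc (M n : ℝ≥0∞)⁻¹ * resMoment hK ρ (lam n)
      ≤ (M n : ℝ≥0∞)⁻¹ * ENNReal.ofReal (Q * lam n ^ (-α) / lam n) := by gcongr
    _ = ENNReal.ofReal ((M n : ℝ)⁻¹ * (Q * lam n ^ (-α) / lam n)) := by
        rw [← ENNReal.ofReal_natCast, ← ENNReal.ofReal_inv_of_pos hMpos,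
          ← ENNReal.ofReal_mul (by positivity)]
    _ ≤ ENNReal.ofReal (A * (N n : ℝ) ^ (-((2 * r - 1) / p))) := by
        refine ENNReal.ofReal_le_ofReal ?_
        have h5 : lam n ^ (-α) ≤ (c * a) ^ (-α) :=
          Real.rpow_le_rpow_of_nonpos (by positivity) hn (by linarith)
        calc (M n : ℝ)⁻¹ * (Q * lam n ^ (-α) / lam n)
            ≤ (c' * N n)⁻¹ * (Q * (c * a) ^ (-α) / (c * a)) := by gcongr
          _ = A * (a ^ (-α) * a⁻¹ * (N n : ℝ)⁻¹) := by
              rw [Real.mul_rpow hc.le hapos.le, hA]; field_simp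
          _ = A * (N n : ℝ) ^ (-((2 * r - 1) / p)) := by
              rw [ha, ← Real.rpow_mul hNpos.le, ← Real.rpow_neg hNpos.le, ← Real.rpow_neg_one,
                ← Real.rpow_add hNpos, ← Real.rpow_add hNpos]
              congr 2
              field_simp
              rw [hp]; ring

end Rates

/-! ### Ranks and separation -/

section Ranks

variable {m : ℕ}

/-- If the estimated values separate `{v ≤ h}` from its complement, the elements of `{v ≤ h}` have
the smallest ranks, however ties are broken. -/
theorem selected_card_eq_transferSet {v w : Fin m → ℝ} {R : Fin m → ℕ} (hR : IsRank w R) {h : ℝ}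
    (hsep : ∀ j i, v j ≤ h → h < v i → w j < w i) :
    selected R (transferSet v h).card = transferSet v h := by
  ext j
  simp only [selected, Finset.mem_filter_univ]
  constructor
  · intro hj
    by_contra hc
    have hc' : h < v j := by simpa [transferSet] using hc
    have hsub : transferSet v h ⊆ ({i | w i < w j} : Finset (Fin m)) := fun i hi => by
      have hi' : v i ≤ h := by simpa [transferSet] using hi
      simpa using hsep i j hi' hc'
    exact absurd ((Finset.card_le_card hsub).trans_lt (hR j).1) (not_lt.2 hj)
  · intro hj
    have hj' : v j ≤ h := by simpa [transferSet] using hj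
    refine (hR j).2.trans (Finset.card_le_card fun i hi => ?_)
    have hi' : w i ≤ w j := by simpa using hi
    by_contra hc
    have hc' : h < v i := by simpa [transferSet] using hc
    exact absurd (hsep j i hj' hc') (not_lt.2 hi')

theorem exists_gap (v : Fin m → ℝ) (h : ℝ) : ∃ δ : ℝ, 0 < δ ∧ ∀ i, h < v i → h + 4 * δ ≤ v i := by
  have h1 : ∀ᶠ δ in 𝓝[>] (0 : ℝ), ∀ i, h < v i → h + 4 * δ ≤ v i := by
    refine eventually_all.2 fun i => ?_
    by_cases hi : h < v i
    · have hlim : Tendsto (fun δ : ℝ => h + 4 * δ) (𝓝[>] 0) (𝓝 h) := by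
        have : Tendsto (fun δ : ℝ => h + 4 * δ) (𝓝 0) (𝓝 (h + 4 * 0)) :=
          Continuous.tendsto (by fun_prop) 0
        rw [mul_zero, add_zero] at this
        exact this.mono_left nhdsWithin_le_nhds
      filter_upwards [hlim.eventually (ge_mem_nhds hi)] with δ hδ _ using hδ
    · exact Eventually.of_forall fun δ hh => absurd hh hi
  obtain ⟨δ, hδ, hpos⟩ := (h1.and self_mem_nhdsWithin).exists
  exact ⟨δ, hpos, hδ⟩

theorem abs_contrast_sub_le {H : Type*} [NormedAddCommGroup H] (f g : Fin (m + 1) → H)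
    (j : Fin m) : |contrast f j - contrast g j| ≤ ‖f j.succ - g j.succ‖ + ‖f 0 - g 0‖ := by
  refine (abs_norm_sub_norm_le _ _).trans ?_
  rw [show f j.succ - f 0 - (g j.succ - g 0) = (f j.succ - g j.succ) - (f 0 - g 0) by abel]
  exact norm_sub_le _ _

end Ranks

end TransferKRR

theorem theorem3 {d m : ℕ}
    -- the compact domain and the RKHS
    (𝒳 : Set (EuclideanSpace ℝ (Fin d))) (h𝒳 : IsCompact 𝒳)
    {H : Type*} [NormedAddCommGroup H] [InnerProductSpace ℝ H] [CompleteSpace H]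
    [TopologicalSpace.SeparableSpace H] [RKHS ℝ H 𝒳 ℝ] (hK : IsBddMeasKernel H)
    -- the common marginal law, the conditional laws and the regression functions
    (ρ : Measure 𝒳) [IsProbabilityMeasure ρ]
    (η : Fin (m + 1) → Kernel 𝒳 ℝ) [∀ k, IsMarkovKernel (η k)]
    (f : Fin (m + 1) → H) (hf : ∀ k, IsRegressionFun ρ (η k) (f k))
    -- the noise condition
    (B γ : ℝ) (hB : 0 < B) (hγ : 0 < γ) (h_noise : ∀ k, NoiseCondition ρ (η k) (f k) B γ)
    -- the capacity condition
    (α Q : ℝ) (hα : 0 < α) (hα1 : α ≤ 1) (hQ : 1 ≤ Q)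
    (h_dim : ∀ t : ℝ, 0 < t → effDim hK ρ t ≤ ENNReal.ofReal (Q * t ^ (-α)))
    -- the source condition
    (r : ℝ) (hr : 1 / 2 < r) (hr1 : r ≤ 1)
    (h_source : ∀ k, ∃ g : Lp ℝ 2 ρ, IsLKPow hK ρ r g (f k))
    -- the sizes of the first part of the target data
    (s : ℕ → ℕ) (hs : ∀ N, s N ≤ N)
    (hs' : ∃ c : ℝ, 0 < c ∧ ∀ᶠ N : ℕ in atTop, c * N ≤ s N)
    -- the samples, for each vector `n = (n_0, …, n_m)` of sample sizes
    {Ω : (Fin (m + 1) → ℕ) → Type*} [∀ n, MeasurableSpace (Ω n)]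
    (P : ∀ n, Measure (Ω n)) [∀ n, IsProbabilityMeasure (P n)]
    (Z : ∀ n, (k : Fin (m + 1)) → Fin (n k) → Ω n → 𝒳 × ℝ)
    (T₁ : ∀ n, Ω n → Finset (Fin (n 0)))
    (h_sample : ∀ n, IsSample (P n) (fun k => ρ ⊗ₘ η k) n (s (n 0)) (Z n) (T₁ n))
    -- the regularization parameters
    (lam : (Fin (m + 1) → ℕ) → Fin (m + 1) → ℝ)
    (h_lam : ∃ c C : ℝ, 0 < c ∧ 0 < C ∧ ∀ n, (∀ k, 1 ≤ n k) → ∀ k,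
      c * (n k : ℝ) ^ (-(1 / (2 * r + α))) ≤ lam n k ∧
      lam n k ≤ C * (n k : ℝ) ^ (-(1 / (2 * r + α))))
    -- the ranks of the estimated contrasts
    (R : ∀ n, Ω n → Fin m → ℕ)
    (hR : ∀ n ω, IsRank (contrast (fHat H (fun k i => Z n k i ω) (T₁ n ω) (lam n))) (R n ω))
    (ℓ : ℕ) (hℓ : ℓ ≤ m) :
    Tendsto
      (fun n => P n {ω | selected (R n ω) (eLevel (contrast f) ℓ) =
        transferSet (contrast f) (hLevel (contrast f) ℓ)})
      (comap (fun n : Fin (m + 1) → ℕ => Finset.univ.inf' Finset.univ_nonempty n) atTop)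
      (𝓝 1) := by

  classical
  obtain ⟨κ, hκ⟩ := hK.exists_norm_le
  obtain ⟨c, C, hc, -, h_lam⟩ := h_lam
  obtain ⟨c', hc', hs'⟩ := hs'
  set F : Filter (Fin (m + 1) → ℕ) :=
    comap (fun n : Fin (m + 1) → ℕ => Finset.univ.inf' Finset.univ_nonempty n) atTop with hF
  have hp : 0 < 2 * r + α := by linarith
  have hn : ∀ k, Tendsto (fun n : Fin (m + 1) → ℕ => n k) F atTop := fun k =>
    tendsto_atTop_mono (fun n => Finset.inf'_le n (Finset.mem_univ k)) tendsto_comap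
  have hn1 : ∀ᶠ n in F, ∀ k, 1 ≤ n k := eventually_all.2 fun k => (hn k).eventually_ge_atTop 1
  have hlam : ∀ k, ∀ᶠ n in F, c * (n k : ℝ) ^ (-(1 / (2 * r + α))) ≤ lam n k ∧
      lam n k ≤ C * (n k : ℝ) ^ (-(1 / (2 * r + α))) := fun k => by
    filter_upwards [hn1] with n h using h_lam n h k
  have hlam0 : ∀ k, Tendsto (fun n => lam n k) F (𝓝[>] 0) := fun k =>
    tendsto_nhdsGT_of_le_rpow (hn k) hp hc (hlam k)
  have hvar : ∀ k, ∀ᵐ x ∂ρ, ∫⁻ y, ‖y - f k x‖ₑ ^ 2 ∂(η k x) ≤ ENNReal.ofReal (γ ^ 2) :=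
    fun k => (h_noise k).ae_lintegral_sq_le hB
  have hfin : ∀ t : ℝ, 0 < t → resMoment hK ρ t ≠ ∞ := fun t ht =>
    ne_top_of_le_ne_top ENNReal.ofReal_ne_top (resMoment_le_of_effDim_le hK ρ ht (h_dim t ht))
  -- each estimator is consistent in the norm of `H`
  have hcons : ∀ δ : ℝ, 0 < δ → ∀ k, Tendsto (fun n => P n {ω |
      δ ≤ ‖fHat H (fun k i => Z n k i ω) (T₁ n ω) (lam n) k - f k‖}) F (𝓝 0) := by
    intro δ hδ k
    set C₀ := ENNReal.ofReal (4 * κ ^ 2 + 64 * γ ^ 2 / δ ^ 2) with hC₀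
    have hbias : ∀ᶠ n in F, 0 < lam n k ∧
        lam n k * ‖regInv (covOp hK ρ) (lam n k) (f k)‖ ≤ δ / 8 := by
      obtain ⟨g, hg⟩ := h_source k
      exact (((eventually_mem_nhdsWithin (a := (0 : ℝ)) (s := Set.Ioi 0)).and
        (tendsto_bias hK ρ (hg.mem_closure_range) (by positivity)))).filter_mono (hlam0 k)
    have hsqueeze : ∀ M : (Fin (m + 1) → ℕ) → ℕ, ∀ a : ℝ, 0 < a →
        (∀ᶠ n in F, a * n k ≤ M n) →
        (∀ᶠ n in F, 1 ≤ M n → P n {ω |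
          δ ≤ ‖fHat H (fun k i => Z n k i ω) (T₁ n ω) (lam n) k - f k‖} ≤
          C₀ * ((M n : ℝ≥0∞)⁻¹ * resMoment hK ρ (lam n k))) →
        Tendsto (fun n => P n {ω |
          δ ≤ ‖fHat H (fun k i => Z n k i ω) (T₁ n ω) (lam n) k - f k‖}) F (𝓝 0) := by
      intro M a ha hM hle
      have h1 := ENNReal.Tendsto.const_mul (a := C₀) (tendsto_inv_mul_resMoment hK ρ hα
        (by linarith) hr h_dim (hn k) ha hM hc ((hlam k).mono fun n h => h.1))
        (Or.inr ENNReal.ofReal_ne_top)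
      rw [mul_zero] at h1
      refine tendsto_of_tendsto_of_tendsto_of_le_of_le' tendsto_const_nhds h1
        (Eventually.of_forall fun _ => zero_le) ?_
      filter_upwards [hM, hle, hn1] with n hMn hlen h1n
      refine hlen ?_
      have h2 : (0 : ℝ) < n k := by exact_mod_cast h1n k
      have h3 : (0 : ℝ) < M n := lt_of_lt_of_le (by positivity) hMn
      exact_mod_cast h3
    cases k using Fin.cases with
    | zero =>
      refine hsqueeze (fun n => s (n 0)) c' hc' ((hn 0).eventually hs') ?_
      filter_upwards [hbias] with n hb hM
      have hS := h_sample n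
      have hex : ∀ A : Finset (Fin (n 0)), A.card = s (n 0) → ∃ 𝓑 : Set (Fin (n 0) → 𝒳 × ℝ),
          MeasurableSet 𝓑 ∧ (∀ z ∉ 𝓑, ‖krr H z A (lam n 0) - f 0‖ < δ) ∧
          P n ((fun ω i => Z n 0 i ω) ⁻¹' 𝓑) ≤
            C₀ * ((s (n 0) : ℝ≥0∞)⁻¹ * resMoment hK ρ (lam n 0)) := by
        intro A hA
        have := exists_bad_set hK (hf 0) (hvar 0) hκ hb.1 hδ (hfin _ hb.1) hb.2
          (hS.measurable_data 0) (hS.law 0) (hS.indep 0) (Finset.card_pos.1 (hA ▸ hM))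
        rwa [hA] at this
      choose! 𝓑 h𝓑m h𝓑 h𝓑P using hex
      refine (measure_mono fun ω hω => ?_).trans (measure_random_subset_le (hs (n 0))
        hS.measurable_split hS.uniform hS.indep_split h𝓑m h𝓑P)
      intro hcard
      by_contra hc
      exact absurd (h𝓑 _ hcard _ hc) (not_lt.2 hω)
    | succ j =>
      refine hsqueeze (fun n => n j.succ) 1 one_pos (Eventually.of_forall fun n => by simp) ?_
      filter_upwards [hbias] with n hb hM
      have hS := h_sample n
      have : NeZero (n j.succ) := ⟨by omega⟩
      obtain ⟨𝓑, -, h𝓑, h𝓑P⟩ := exists_bad_set hK (hf j.succ) (hvar j.succ) hκ hb.1 hδ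
        (hfin _ hb.1) hb.2 (hS.measurable_data j.succ) (hS.law j.succ) (hS.indep j.succ)
        (Finset.univ_nonempty (α := Fin (n j.succ)))
      rw [Finset.card_univ, Fintype.card_fin] at h𝓑P
      refine (measure_mono fun ω hω => ?_).trans h𝓑P
      by_contra hc
      exact absurd (h𝓑 _ hc) (not_lt.2 hω)
  -- small errors at all `k` separate the estimated contrasts at the level `h_ℓ`
  set h := hLevel (contrast f) ℓ with hh
  obtain ⟨δ, hδ, hgap⟩ := exists_gap (contrast f) h
  have hsum := tendsto_finsetSum Finset.univ fun k _ => hcons δ hδ k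
  rw [Finset.sum_const_zero] at hsum
  have hlow := ENNReal.Tendsto.sub (tendsto_const_nhds (x := (1 : ℝ≥0∞)) (f := F)) hsum
    (Or.inl ENNReal.one_ne_top)
  rw [tsub_zero] at hlow
  refine tendsto_of_tendsto_of_tendsto_of_le_of_le hlow tendsto_const_nhds (fun n => ?_)
    fun n => prob_le_one
  refine tsub_le_iff_right.2 ?_
  rw [← measure_univ (μ := P n)]
  refine le_trans (measure_mono fun ω _ => ?_) ((measure_union_le _ _).trans
    (add_le_add_right (measure_iUnion_fintype_le _ _) _))
  by_cases hω : ∃ k, δ ≤ ‖fHat H (fun k i => Z n k i ω) (T₁ n ω) (lam n) k - f k‖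
  · exact Or.inr (Set.mem_iUnion.2 hω)
  · left
    push Not at hω
    refine selected_card_eq_transferSet (hR n ω) fun j i hj hi => ?_
    have h1 := abs_le.1 (abs_contrast_sub_le
      (fHat H (fun k i => Z n k i ω) (T₁ n ω) (lam n)) f j)
    have h2 := abs_le.1 (abs_contrast_sub_le
      (fHat H (fun k i => Z n k i ω) (T₁ n ω) (lam n)) f i)
    have h3 := hgap i hi
    have h4 := hω 0
    have h5 := hω j.succ
    have h6 := hω i.succ
    linarith [h1.2, h2.1]
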